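/- All graphs are finite and simple. For a non-negative integer $k$, the $k$-visibility Localization game on a connected graph $G$ is played by $m\ge 1$ cops against a robber. The robber first chooses a vertex. In each round the $m$ cops are placed on arbitrary vertices $u_1,\dots,u_m$, and receive the distance vector $(d_1,\dots,d_m)$, where $d_i$ is the distance from $u_i$ to the robber's vertex if this distance is at most $k$, and $d_i=\ast$ otherwise; then the robber stays or moves to a neighboring vertex. The placement of the cops in a round may depend on all distance vectors received before. The cops win if they have a strategy such that, whatever the robber does, after finitely many rounds exactly one vertex is consistent, as the robber's current position, with all the distance vectors received so far. Let $\zeta_k(G)$ be the least positive integer $m$ such that $m$ cops win, and let $\mathrm{rad}(G)=\min_u\max_v d(u,v)$ be the radius of $G$. (1) For every sequence of trees $(T_n)_{n\ge1}$ with $\mathrm{rad}(T_n)\to\infty$ and every continuous function $f:[0,\infty)\to[0,\infty)$ with $f(n)=\Omega(\sqrt n)$ as $n\to\infty$ through the integers, there exists a constant $d$ such that, with $k=k(n)=\lfloor f(\mathrm{rad}(T_n))\rfloor$, $$\limsup_{n\to\infty}\zeta_k(T_n)\le d.$$ (2) For every continuous function $f:[0,\infty)\to[0,\infty)$ with $f(n)=o(\sqrt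 n)$ as $n\to\infty$ through the integers, there exists a sequence of trees $(T_n)_{n\ge1}$ with $\mathrm{rad}(T_n)\to\infty$ such that, with $k=k(n)=\lfloor f(\mathrm{rad}(T_n))\rfloor$, $$\lim_{n\to\infty}\zeta_k(T_n)=\infty.$$ -/

import Mathlib

universe u

open Filter Topology Asymptotics

namespace VisibilityLocalization

variable {V : Type*}

open Classical in
/-- The answer to the probe of a cop on `c` with visibility `k` when the robber is on `x`:
the distance if it is at most `k`, and `none` (the answer `∗`) otherwise. -/
noncomputable def probe (G : SimpleGraph V) (k : ℕ) (c x : V) : Option ℕ :=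
  if G.edist c x ≤ k then some (G.dist c x) else none

/-- The distance vector obtained by `m` cops placed on `u` when the robber is on `x`. -/
noncomputable def distVector (G : SimpleGraph V) (k : ℕ) {m : ℕ} (u : Fin m → V) (x : V) :
    Fin m → Option ℕ :=
  fun i => probe G k (u i) x

/-- A strategy for `m` cops: the distance vectors received so far (oldest first) determine
the next placement of the cops, on arbitrary vertices. -/
abbrev CopStrategy (V : Type*) (m : ℕ) : Type _ :=
  List (Fin m → Option ℕ) → Fin m → V

/-- The possible courses of the robber: `x t` is the position of the robber when the cops are
placed for the `(t + 1)`-st time; in between, the robber stays or moves to a neighbor. -/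
def IsRobberCourse (G : SimpleGraph V) (x : ℕ → V) : Prop :=
  ∀ t, x (t + 1) = x t ∨ G.Adj (x t) (x (t + 1))

/-- The distance vectors received in the first `t` rounds, oldest first, when the cops follow `σ`
and the robber follows `x`. -/
noncomputable def history (G : SimpleGraph V) (k : ℕ) {m : ℕ} (σ : CopStrategy V m)
    (x : ℕ → V) : ℕ → List (Fin m → Option ℕ)
  | 0 => []
  | t + 1 => history G k σ x t ++ [distVector G k (σ (history G k σ x t)) (x t)]

/-- The candidates after the cops' probe in round `t` (rounds are counted from `0`): all positions
of the robber which are consistent with all the distance vectors received up to then. -/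
def candidates (G : SimpleGraph V) (k : ℕ) {m : ℕ} (σ : CopStrategy V m) (x : ℕ → V) (t : ℕ) :
    Set V :=
  {v | ∃ y : ℕ → V, IsRobberCourse G y ∧
    history G k σ y (t + 1) = history G k σ x (t + 1) ∧ y t = v}

/-- A strategy is winning if, whatever the robber does, after finitely many rounds there is a
unique candidate. -/
def IsWinning (G : SimpleGraph V) (k : ℕ) {m : ℕ} (σ : CopStrategy V m) : Prop :=
  ∀ x : ℕ → V, IsRobberCourse G x → ∃ t, ∃ v, candidates G k σ x t = {v}

/-- The `k`-visibility localization number `ζ_k(G)`: the least positive `m` such that `m` cops have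
a winning strategy. -/
noncomputable def zeta (k : ℕ) (G : SimpleGraph V) : ℕ :=
  sInf {m : ℕ | 0 < m ∧ ∃ σ : CopStrategy V m, IsWinning G k σ}

/-- On a finite nonempty graph the minimum defining `zeta` is attained. -/
theorem zeta_spec [Finite V] [Nonempty V] (k : ℕ) (G : SimpleGraph V) :
    0 < zeta k G ∧ ∃ σ : CopStrategy V (zeta k G), IsWinning G k σ := by
  refine Nat.sInf_mem (s := {m : ℕ | 0 < m ∧ ∃ σ : CopStrategy V m, IsWinning G k σ})
    ⟨Nat.card V, Nat.card_pos, fun _ => (Finite.equivFin V).symm, fun x hx => ⟨0, x 0, ?_⟩⟩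
  ext v
  simp only [candidates, history, Set.mem_setOf_eq, Set.mem_singleton_iff, List.nil_append,
    zero_add, List.cons.injEq, and_true]
  refine ⟨?_, fun h => ⟨x, hx, rfl, h.symm⟩⟩
  rintro ⟨y, -, h, rfl⟩
  have h0 := congrFun h (Finite.equivFin V (x 0))
  simp only [distVector, probe, Equiv.symm_apply_apply, SimpleGraph.edist_self, zero_le,
    if_true, SimpleGraph.dist_self] at h0
  split_ifs at h0 with hle
  have hne : G.edist (x 0) (y 0) ≠ ⊤ := ne_top_of_le_ne_top (ENat.coe_ne_top k) hle
  have hr : G.Reachable (x 0) (y 0) := SimpleGraph.edist_ne_top_iff_reachable.mp hne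
  exact (hr.dist_eq_zero_iff.mp (Option.some.inj h0)).symm

end VisibilityLocalization

/-- The radius of a graph as a natural number (meaningful for finite connected graphs). -/
noncomputable def natRadius {V : Type*} (G : SimpleGraph V) : ℕ := G.radius.toNat

/-!
The threshold `√rad` for the visibility `k` comes from time-sharing. A cop who probes a vertex `u`
without seeing the robber knows that the robber cannot reach `u` in the next `k` moves, so that one
cop can guard about `k` vertices in turn. Guards at mutual distance about `k` along a path of length
`rad` thus require about `rad / k ^ 2` cops.

**Upper bound.** Root the tree at a center. One cop stays on a vertex `v` whose subtree is known to
contain the robber, and the subtrees of the children of `v` are swept one after another. A sweep is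
a depth-first traversal in steps of length `k / 2`, each stack of which is kept for `k / 2` rounds;
in every round a residue class of the stack is probed, together with the parents of its members. A
robber who is never sighted cannot move between the subtrees hanging at a guarded vertex
(`mem_subtree_of_unsighted`), hence is not in the swept subtree (`exists_sighting`). A robber who is
sighted below a guard `u` is known to be in the subtree of `u`, because the parent of `u` is probed
as well (`mem_subtree_of_probe_eq`), and `u` is deeper than `v`. So the cops win by induction on the
height (`copsWin_subtree`); the game itself is treated via belief sets (`CopsWin`), and ends with a
cop on the robber, who receives the answer `0` (`isWinning_of_capture`).

**Lower bound.** In the complete `D`-ary tree of height `r`, with `D` very large, a robber can stay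
unseen forever. To clean a contaminated subtree completely, there must be a time window of length
`O(k)` with many visits to this subtree, the number being linear in the height divided by `k`
(`exists_many_visits`): while the first of many branches at a vertex `v` is being cleaned, some cop
has to guard `v` in every window of this length, since otherwise almost all branches become
contaminated again. As `m` cops make only `O(m * k)` visits in such a window, they fail if `r` is
large compared with `m * k ^ 2`. So the set of possible positions of an unseen robber always has two
elements, and a compactness argument provides a course which is never seen (`exists_unseen_course`).
-/

namespace VisibilityLocalization

variable {V : Type*}

/-! ### Winning by capture -/

/-- The positions a robber can occupy after one move from a position in `A`. -/
def reach (G : SimpleGraph V) (A : Set V) : Set V :=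
  {z | ∃ y ∈ A, z = y ∨ G.Adj y z}

/-- `CopsWin G k m S`: knowing that the robber is in `S`, and about to probe, `m` cops can force
one of them to be placed on the robber. A placement `u` splits the positions in `S` that avoid the
cops according to the distance vector, and each class has to be winning after the robber's move. -/
inductive CopsWin (G : SimpleGraph V) (k m : ℕ) : Set V → Prop
  | step {S : Set V} (u : Fin m → V)
      (h : ∀ x ∈ S, (∀ i, u i ≠ x) → CopsWin G k m
        (reach G {y | y ∈ S ∧ distVector G k u y = distVector G k u x ∧ ∀ i, u i ≠ y})) :
      CopsWin G k m S

theorem reach_mono (G : SimpleGraph V) {A B : Set V} (h : A ⊆ B) : reach G A ⊆ reach G B :=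
  fun _ ⟨y, hy, hz⟩ => ⟨y, h hy, hz⟩

theorem CopsWin.mono {G : SimpleGraph V} {k m : ℕ} {S S' : Set V} (h : CopsWin G k m S)
    (hS : S' ⊆ S) : CopsWin G k m S' := by
  induction h generalizing S' with
  | step u _ ih =>
    exact .step u fun x hx hu => ih x (hS hx) hu (reach_mono G fun y hy => ⟨hS hy.1, hy.2⟩)

/-- The history after the first round is the first answer followed by the history of the residual
strategy against the remaining course. -/
theorem history_succ_eq_cons (G : SimpleGraph V) (k : ℕ) {m : ℕ} (σ : CopStrategy V m)
    (x : ℕ → V) (t : ℕ) :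
    history G k σ x (t + 1) = distVector G k (σ []) (x 0) ::
      history G k (fun h => σ (distVector G k (σ []) (x 0) :: h)) (fun t => x (t + 1)) t := by
  induction t with
  | zero => rfl
  | succ t ih =>
    rw [history, ih, List.cons_append]
    rfl

theorem IsRobberCourse.shift {G : SimpleGraph V} {x : ℕ → V} (hx : IsRobberCourse G x) (s : ℕ) :
    IsRobberCourse G fun t => x (s + t) :=
  fun t => hx (s + t)

theorem CopsWin.exists_strategy {G : SimpleGraph V} {k m : ℕ} {S : Set V} (h : CopsWin G k m S) :
    ∃ σ : CopStrategy V m, ∀ x, IsRobberCourse G x → x 0 ∈ S →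
      ∃ t i, σ (history G k σ x t) i = x t := by
  induction h with
  | @step S u h ih =>
    have key : ∀ a : Fin m → Option ℕ, ∃ τ : CopStrategy V m, ∀ x, IsRobberCourse G x →
        x 0 ∈ reach G {y | y ∈ S ∧ distVector G k u y = a ∧ ∀ i, u i ≠ y} →
        ∃ t i, τ (history G k τ x t) i = x t := by
      intro a
      by_cases hz : ∃ z ∈ S, (∀ i, u i ≠ z) ∧ distVector G k u z = a
      · obtain ⟨z, hzS, hzu, rfl⟩ := hz
        exact ih z hzS hzu
      · refine ⟨fun _ => u, ?_⟩
        rintro x - ⟨y, ⟨hyS, hya, hyu⟩, -⟩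
        exact absurd ⟨y, hyS, hyu, hya⟩ hz
    choose τ hτ using key
    refine ⟨fun h => match h with
      | [] => u
      | a :: h => τ a h, fun x hx hxS => ?_⟩
    by_cases hu : ∃ i, u i = x 0
    · exact ⟨0, hu⟩
    · push Not at hu
      obtain ⟨t, i, hti⟩ := hτ (distVector G k u (x 0)) (fun t => x (t + 1))
        (fun t => hx (t + 1)) ⟨x 0, ⟨hxS, rfl, hu⟩, hx 0⟩
      refine ⟨t + 1, i, ?_⟩
      rw [history_succ_eq_cons]
      exact hti

theorem probe_self (G : SimpleGraph V) (k : ℕ) (c : V) : probe G k c c = some 0 := by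
  simp [probe]

theorem eq_of_probe_eq_some_zero {G : SimpleGraph V} {k : ℕ} {c x : V}
    (h : probe G k c x = some 0) : c = x := by
  unfold probe at h
  split_ifs at h with hle
  have hne : G.edist c x ≠ ⊤ := fun h => by simp [h] at hle
  exact (SimpleGraph.edist_ne_top_iff_reachable.mp hne).dist_eq_zero_iff.mp (Option.some.inj h)

/-- A cop placed on the robber receives the answer `0`, which leaves a single candidate. -/
theorem isWinning_of_capture {G : SimpleGraph V} {k m : ℕ} {σ : CopStrategy V m}
    (h : ∀ x, IsRobberCourse G x → ∃ t i, σ (history G k σ x t) i = x t) :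
    IsWinning G k σ := by
  intro x hx
  obtain ⟨t, i, hti⟩ := h x hx
  refine ⟨t, x t, Set.eq_singleton_iff_unique_mem.mpr ⟨⟨x, hx, rfl, rfl⟩, ?_⟩⟩
  rintro _ ⟨y, -, hyx, rfl⟩
  obtain ⟨h1, h2⟩ := List.append_inj' hyx rfl
  rw [h1, List.cons.injEq] at h2
  have h3 := congrFun h2.1 i
  simp only [distVector, hti, probe_self] at h3
  exact (eq_of_probe_eq_some_zero h3).symm

theorem zeta_le_of_copsWin {G : SimpleGraph V} {k m : ℕ} (hm : 0 < m)
    (h : CopsWin G k m Set.univ) : zeta k G ≤ m := by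
  obtain ⟨σ, hσ⟩ := h.exists_strategy
  exact Nat.sInf_le ⟨hm, σ, isWinning_of_capture fun x hx => hσ x hx trivial⟩

/-- A step of the game in terms of the set `C` of the vertices occupied by cops. -/
theorem CopsWin.step_finset {G : SimpleGraph V} {k m : ℕ} {S : Set V} (C : Finset V)
    (hC : C.Nonempty) (hm : C.card ≤ m)
    (h : ∀ x ∈ S, x ∉ C → CopsWin G k m
      (reach G {y | y ∈ S ∧ (∀ c ∈ C, probe G k c y = probe G k c x) ∧ y ∉ C})) :
    CopsWin G k m S := by
  obtain ⟨c₀, hc₀⟩ := hC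
  let u : Fin m → V := fun i => if hi : i.1 < C.card then C.equivFin.symm ⟨i, hi⟩ else c₀
  have hu : ∀ c, c ∈ C ↔ ∃ i, u i = c := by
    intro c
    constructor
    · intro hc
      refine ⟨⟨C.equivFin ⟨c, hc⟩, (C.equivFin ⟨c, hc⟩).2.trans_le hm⟩, ?_⟩
      simp [u]
    · rintro ⟨i, rfl⟩
      dsimp only [u]
      split_ifs with hi
      · exact (C.equivFin.symm ⟨i, hi⟩).2
      · exact hc₀
  refine .step u fun x hx hxu => (h x hx ?_).mono (reach_mono G ?_)
  · rw [hu]; push Not; exact hxu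
  · rintro y ⟨hy, hyx, hyu⟩
    refine ⟨hy, fun c hc => ?_, ?_⟩
    · obtain ⟨i, rfl⟩ := (hu c).1 hc
      exact congrFun hyx i
    · rw [hu]; push Not; exact hyu

/-! ### Rooted trees -/

/-- The vertices below `u` (including `u`) when `G` is rooted at `o`: those `x` for which some
shortest path from `o` to `x` passes through `u`. -/
def subtree (G : SimpleGraph V) (o u : V) : Set V :=
  {x | G.dist o u + G.dist u x = G.dist o x}

section Rooted

variable {G : SimpleGraph V} {o u v w x y p q : V}

theorem mem_subtree : x ∈ subtree G o u ↔ G.dist o u + G.dist u x = G.dist o x := Iff.rfl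

theorem mem_subtree_self : u ∈ subtree G o u := by simp [subtree]

theorem mem_subtree_root : x ∈ subtree G o o := by simp [subtree]

theorem dist_add_of_mem_subtree (hG : G.Connected) (hx : x ∈ subtree G o u)
    (hu : u ∈ subtree G o v) : G.dist v u + G.dist u x = G.dist v x := by
  rw [mem_subtree] at *
  have h1 := hG.dist_triangle (u := v) (v := u) (w := x)
  have h2 := hG.dist_triangle (u := o) (v := v) (w := x)
  lia

theorem mem_subtree_trans (hG : G.Connected) (hx : x ∈ subtree G o u)
    (hu : u ∈ subtree G o v) : x ∈ subtree G o v := by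
  have h := dist_add_of_mem_subtree hG hx hu
  rw [mem_subtree] at *
  lia

theorem mem_subtree_of_adj (h : G.Adj u x) (hd : G.dist o x = G.dist o u + 1) :
    x ∈ subtree G o u := by
  rw [mem_subtree, SimpleGraph.dist_eq_one_iff_adj.mpr h, hd]

/-- A descendant at distance at least `l` lies below some descendant at distance exactly `l`. -/
theorem exists_mem_subtree_of_le_dist (hG : G.Connected) (hx : x ∈ subtree G o u) {l : ℕ}
    (hl : l ≤ G.dist u x) : ∃ v ∈ subtree G o u, G.dist u v = l ∧ x ∈ subtree G o v := by
  obtain ⟨W, hW⟩ := hG.exists_walk_length_eq_dist u x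
  have h1 := SimpleGraph.dist_le (W.take l)
  have h2 := SimpleGraph.dist_le (W.drop l)
  rw [SimpleGraph.Walk.take_length] at h1
  rw [SimpleGraph.Walk.drop_length] at h2
  have h3 := hG.dist_triangle (u := u) (v := W.getVert l) (w := x)
  have h4 := hG.dist_triangle (u := o) (v := u) (w := W.getVert l)
  have h5 := hG.dist_triangle (u := o) (v := W.getVert l) (w := x)
  rw [mem_subtree] at hx
  refine ⟨W.getVert l, ?_, by lia, ?_⟩ <;> rw [mem_subtree] <;> lia

theorem exists_parent (hG : G.Connected) (hx : x ∈ subtree G o u) (hne : x ≠ u) :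
    ∃ p ∈ subtree G o u, G.Adj p x ∧ G.dist o x = G.dist o p + 1 := by
  have h0 : 0 < G.dist u x := hG.pos_dist_of_ne hne.symm
  obtain ⟨p, hp, hpl, hpx⟩ := exists_mem_subtree_of_le_dist hG hx (Nat.sub_le (G.dist u x) 1)
  have h1 := dist_add_of_mem_subtree hG hpx hp
  have h2 : G.dist p x = 1 := by lia
  refine ⟨p, hp, SimpleGraph.dist_eq_one_iff_adj.mp h2, ?_⟩
  rw [mem_subtree, h2] at hpx
  exact hpx.symm

theorem parent_unique (hG : G.IsTree) (hp : G.Adj p x) (hpd : G.dist o x = G.dist o p + 1)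
    (hq : G.Adj q x) (hqd : G.dist o x = G.dist o q + 1) : p = q := by
  obtain ⟨P, hP⟩ := hG.1.exists_walk_length_eq_dist o p
  obtain ⟨Q, hQ⟩ := hG.1.exists_walk_length_eq_dist o q
  have hP' : (P.concat hp).IsPath := by
    apply SimpleGraph.Walk.isPath_of_length_eq_dist
    rw [SimpleGraph.Walk.length_concat, hP, hpd]
  have hQ' : (Q.concat hq).IsPath := by
    apply SimpleGraph.Walk.isPath_of_length_eq_dist
    rw [SimpleGraph.Walk.length_concat, hQ, hqd]
  have h := congrArg Subtype.val ((hG.2.subsingleton_path _ _).elim ⟨_, hP'⟩ ⟨_, hQ'⟩)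
  exact (SimpleGraph.Walk.concat_inj h).1

/-- A subtree can be left only from its top vertex. -/
theorem mem_subtree_of_adj_of_ne (hG : G.IsTree) (hx : x ∈ subtree G o u) (hne : x ≠ u)
    (h : G.Adj x y) : y ∈ subtree G o u := by
  rcases hG.dist_eq_dist_add_one_of_adj o h with hd | hd
  · obtain ⟨p, hp, hpx, hpd⟩ := exists_parent hG.1 hx hne
    rwa [parent_unique hG h.symm hd hpx hpd]
  · exact mem_subtree_trans hG.1 (mem_subtree_of_adj h hd) hx

theorem reach_subset_subtree (hG : G.IsTree) {A : Set V} (hA : A ⊆ subtree G o u) (hu : u ∉ A) :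
    reach G A ⊆ subtree G o u := by
  rintro z ⟨y, hy, rfl | hyz⟩
  · exact hA hy
  · exact mem_subtree_of_adj_of_ne hG (hA hy) (fun h => hu (h ▸ hy)) hyz

/-- A subtree can be entered only from the parent of its top vertex. -/
theorem dist_of_notMem_subtree (hG : G.IsTree) (hp : G.Adj p u)
    (hpd : G.dist o u = G.dist o p + 1) (hx : x ∉ subtree G o u) :
    G.dist p x + 1 ≤ G.dist u x := by
  have key : ∀ {a b : V} (W : G.Walk a b), b = u → a ∉ subtree G o u →
      G.dist p a + 1 ≤ W.length := by
    intro a b W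
    induction W with
    | nil => rintro rfl ha; exact absurd mem_subtree_self ha
    | @cons a c b h W ih =>
      rintro rfl ha
      rw [SimpleGraph.Walk.length_cons]
      by_cases hc : c ∈ subtree G o b
      · have hcb : c = b := by
          by_contra hne
          exact ha (mem_subtree_of_adj_of_ne hG hc hne h.symm)
        subst hcb
        rcases hG.dist_eq_dist_add_one_of_adj o h with hd | hd
        · exact absurd (mem_subtree_of_adj h.symm hd) ha
        · rw [parent_unique hG hp hpd h hd]
          simp
      · have h1 := ih rfl hc
        have h2 := hG.1.dist_triangle (u := p) (v := c) (w := a)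
        rw [SimpleGraph.dist_eq_one_iff_adj.mpr h.symm] at h2
        lia
  obtain ⟨W, hW⟩ := hG.1.exists_walk_length_eq_dist x u
  rw [SimpleGraph.dist_comm (u := u), ← hW]
  exact key W rfl hx

theorem probe_eq (hG : G.Connected) (k : ℕ) (c x : V) :
    probe G k c x = if G.dist c x ≤ k then some (G.dist c x) else none := by
  unfold probe
  rw [← (hG c x).coe_dist_eq_edist]
  simp

/-- If the robber is seen in the subtree of `u` by a cop on `u`, then this cop and one on the
parent of `u` together prove that the robber is in that subtree. -/
theorem mem_subtree_of_probe_eq (hG : G.IsTree) {k : ℕ} (hp : G.Adj p u)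
    (hpd : G.dist o u = G.dist o p + 1) (hx : x ∈ subtree G o u) (hxk : G.dist u x ≤ k)
    (hu : probe G k u y = probe G k u x) (hpy : probe G k p y = probe G k p x) :
    y ∈ subtree G o u := by
  by_contra hy
  have h1 := dist_of_notMem_subtree hG hp hpd hy
  have h2 := dist_add_of_mem_subtree hG.1 hx (mem_subtree_of_adj hp hpd)
  rw [SimpleGraph.dist_eq_one_iff_adj.mpr hp] at h2
  rw [probe_eq hG.1, probe_eq hG.1, if_pos hxk] at hu
  rw [probe_eq hG.1, probe_eq hG.1] at hpy
  split_ifs at hu hpy <;> grind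

end Rooted

/-! ### Sweeping a subtree with time-shared guards -/

open Classical in
/-- The descendants of `u` at distance `l`, in some order. -/
noncomputable def descendants [Finite V] (G : SimpleGraph V) (o : V) (l : ℕ) (u : V) : List V :=
  (Set.toFinite {v | v ∈ subtree G o u ∧ G.dist u v = l}).toFinset.toList

/-- The stacks occurring in a depth-first traversal, in steps of length `l`, of the subtree of `u`
down to `n` steps; `st` is the stack of the traversal when it arrives at `u`. -/
noncomputable def traversal [Finite V] (G : SimpleGraph V) (o : V) (l : ℕ) :
    ℕ → List V → V → List (List V)
  | 0, st, u => [u :: st]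
  | n + 1, st, u =>
    (u :: st) :: (descendants G o l u).flatMap (traversal G o l n (u :: st))

/-- The members of a stack whose height in the stack is congruent to `j` modulo `s`. -/
def residueClass (s j : ℕ) : List V → List V
  | [] => []
  | u :: st => if st.length % s = j then u :: residueClass s j st else residueClass s j st

section Sweep

variable {G : SimpleGraph V} {o : V}

theorem mem_descendants [Finite V] {l : ℕ} {u v : V} :
    v ∈ descendants G o l u ↔ v ∈ subtree G o u ∧ G.dist u v = l := by
  simp [descendants]

theorem mem_residueClass_of_suffix {s : ℕ} {u : V} {st S : List V} (h : u :: st <:+ S) :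
    u ∈ residueClass s (st.length % s) S := by
  induction S with
  | nil => simp at h
  | cons a S ih =>
    rw [List.suffix_cons_iff] at h
    rcases h with h | h
    · obtain ⟨rfl, rfl⟩ := List.cons.inj h
      simp [residueClass]
    · rw [residueClass]
      split_ifs
      · exact List.mem_cons_of_mem _ (ih h)
      · exact ih h

theorem mem_of_mem_residueClass {s j : ℕ} {u : V} {S : List V} (h : u ∈ residueClass s j S) :
    u ∈ S := by
  induction S with
  | nil => exact h
  | cons a S ih =>
    rw [residueClass] at h
    split_ifs at h
    · rcases List.mem_cons.mp h with rfl | h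
      · exact List.mem_cons_self
      · exact List.mem_cons_of_mem _ (ih h)
    · exact List.mem_cons_of_mem _ (ih h)

theorem length_residueClass_le {s j : ℕ} (hj : j < s) (S : List V) :
    (residueClass s j S).length ≤ S.length / s + 1 := by
  have key : (residueClass s j S).length = Nat.count (· ≡ j [MOD s]) S.length := by
    induction S with
    | nil => rfl
    | cons a S ih =>
      rw [List.length_cons, Nat.count_succ, ← ih, residueClass]
      simp only [Nat.ModEq, Nat.mod_eq_of_lt hj]
      split_ifs <;> simp
  rw [key, Nat.count_modEq_card _ (by lia)]
  split_ifs <;> lia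

theorem suffix_of_mem_traversal [Finite V] {l n : ℕ} {st S : List V} {u : V}
    (h : S ∈ traversal G o l n st u) : u :: st <:+ S := by
  induction n generalizing st u with
  | zero => rw [traversal, List.mem_singleton] at h; exact h ▸ List.suffix_rfl
  | succ n ih =>
    rw [traversal, List.mem_cons, List.mem_flatMap] at h
    rcases h with rfl | ⟨v, -, h⟩
    · exact List.suffix_rfl
    · exact (List.suffix_cons _ _).trans (ih h)

theorem length_le_of_mem_traversal [Finite V] {l n : ℕ} {st S : List V} {u : V}
    (h : S ∈ traversal G o l n st u) : S.length ≤ st.length + n + 1 := by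
  induction n generalizing st u with
  | zero => rw [traversal, List.mem_singleton] at h; simp [h]
  | succ n ih =>
    rw [traversal, List.mem_cons, List.mem_flatMap] at h
    rcases h with rfl | ⟨v, -, h⟩
    · simp
    · have := ih h
      simp at this
      lia

theorem mem_subtree_of_mem_traversal [Finite V] (hG : G.Connected) {l n : ℕ} {st S : List V}
    {u c w : V} (hu : u ∈ subtree G o w) (hst : ∀ c ∈ st, c ∈ subtree G o w)
    (h : S ∈ traversal G o l n st u) (hc : c ∈ S) : c ∈ subtree G o w := by
  induction n generalizing st u with
  | zero =>
    rw [traversal, List.mem_singleton] at h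
    subst h
    rcases List.mem_cons.mp hc with rfl | hc
    exacts [hu, hst c hc]
  | succ n ih =>
    have hst' : ∀ c ∈ u :: st, c ∈ subtree G o w := by
      intro c hc
      rcases List.mem_cons.mp hc with rfl | hc
      exacts [hu, hst c hc]
    rw [traversal, List.mem_cons, List.mem_flatMap] at h
    rcases h with rfl | ⟨v, hv, h⟩
    · exact hst' c hc
    · exact ih (mem_subtree_trans hG (mem_descendants.mp hv).1 hu) hst' h

theorem dist_le_dist_succ (hG : G.Connected) {x : ℕ → V} (hx : IsRobberCourse G x) (u : V)
    (t : ℕ) : G.dist u (x t) ≤ G.dist u (x (t + 1)) + 1 := by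
  rcases hx t with h | h
  · rw [h]; lia
  · have := hG.dist_triangle (u := u) (v := x (t + 1)) (w := x t)
    rwa [SimpleGraph.dist_eq_one_iff_adj.mpr h.symm] at this

/-- A robber who stays in the subtree of `u` and escapes the guard on `u` in every `s`-th round
stays in the subtree of a single descendant at distance `l`: to change between two of these
subtrees takes too long a time within distance `k` of `u`. -/
theorem mem_subtree_of_unsighted (hG : G.IsTree) {l s k i N : ℕ} (hs : 1 ≤ s) (hlk : l + s ≤ k)
    {u v : V} {x : ℕ → V} (hx : IsRobberCourse G x) (hv : v ∈ subtree G o u)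
    (hvl : G.dist u v = l) (hi : x i ∈ subtree G o v)
    (hun : ∀ t, i ≤ t → t < N → (t - i) % s = 0 → k < G.dist u (x t)) :
    ∀ t, i ≤ t → t < N → x t ∈ subtree G o v ∧ k < G.dist u (x t) + (t - i) % s := by
  intro t hit
  induction t, hit using Nat.le_induction with
  | base =>
    intro hN
    exact ⟨hi, (hun i le_rfl hN (by simp)).trans_le (Nat.le_add_right _ _)⟩
  | succ t hit ih =>
    intro hN
    obtain ⟨h1, h2⟩ := ih (by lia)
    have hlt : (t - i) % s < s := Nat.mod_lt _ hs
    refine ⟨?_, ?_⟩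
    · have h3 := dist_add_of_mem_subtree hG.1 h1 hv
      have hne : x t ≠ v := by
        intro h
        rw [h, SimpleGraph.dist_self] at h3
        rw [h] at h2
        lia
      rcases hx t with h | h
      · rwa [h]
      · exact mem_subtree_of_adj_of_ne hG h1 hne h
    · by_cases h0 : (t + 1 - i) % s = 0
      · have := hun (t + 1) (by lia) hN h0
        lia
      · have h4 := dist_le_dist_succ hG.1 hx u t
        have h5 : (t + 1 - i) % s = (t - i) % s + 1 := by
          rw [show t + 1 - i = (t - i) + 1 by lia] at h0 ⊢
          rw [Nat.add_mod_eq_ite] at h0 ⊢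
          rcases Nat.lt_or_ge 1 s with hs1 | hs1
          · rw [Nat.mod_eq_of_lt hs1] at h0 ⊢
            split_ifs at h0 ⊢ <;> lia
          · obtain rfl : s = 1 := by lia
            simp [Nat.mod_one] at h0
        lia

/-- If every stack of the traversal is kept for `s` rounds, its member of height `i` being probed
in the round `i` modulo `s`, then a robber staying in the subtree of `u` is sighted. -/
theorem exists_sighting [Finite V] (hG : G.IsTree) {l s k : ℕ} (hs : 1 ≤ s)
    (hlk : l + s ≤ k) (n : ℕ) : ∀ (st : List V) (u : V) (x : ℕ → V), IsRobberCourse G x →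
      (∀ y ∈ subtree G o u, G.dist u y < (n + 1) * l) →
      (∀ t < s * (traversal G o l n st u).length, x t ∈ subtree G o u) →
      ∃ b, ∃ hb : b < (traversal G o l n st u).length, ∃ j < s,
        ∃ c ∈ residueClass s j (traversal G o l n st u)[b],
          x (s * b + j) ∈ subtree G o c ∧ G.dist c (x (s * b + j)) ≤ k := by
  induction n with
  | zero =>
    intro st u x hx hh hxu
    have hj := Nat.mod_lt st.length hs
    have h0 : x (st.length % s) ∈ subtree G o u := hxu _ (by simpa [traversal] using hj)
    refine ⟨0, by simp [traversal], st.length % s, hj, u, ?_, by simpa using h0, ?_⟩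
    · exact mem_residueClass_of_suffix (suffix_of_mem_traversal (List.getElem_mem _))
    · have := hh _ h0
      simp only [mul_zero, zero_add] at this ⊢
      lia
  | succ n ih =>
    intro st u x hx hh hxu
    by_contra! hcon
    set L := traversal G o l (n + 1) st u with hL
    set i := st.length % s with hi
    have hj : i < s := Nat.mod_lt st.length hs
    have hun : ∀ t, i ≤ t → t < s * L.length → (t - i) % s = 0 → k < G.dist u (x t) := by
      intro t hit htN h0
      have ht : s * ((t - i) / s) + i = t := by
        have := Nat.div_add_mod (t - i) s
        lia
      have hb : (t - i) / s < L.length := by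
        rw [Nat.div_lt_iff_lt_mul hs, mul_comm]
        lia
      have := hcon _ hb i hj u
        (mem_residueClass_of_suffix (suffix_of_mem_traversal (List.getElem_mem _)))
      rw [ht] at this
      exact this (hxu t htN)
    have hLlen : L.length = 1 + ((descendants G o l u).flatMap
        (traversal G o l n (u :: st))).length := by
      rw [hL, traversal, List.length_cons, add_comm]
    have hiN : i < s * L.length := 
      hj.trans_le (Nat.le_mul_of_pos_right _ (by lia))
    have hik := hun i le_rfl hiN (by simp)
    obtain ⟨v, hv, hvl, hiv⟩ := exists_mem_subtree_of_le_dist hG.1 (hxu i hiN) (l := l) (by lia)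
    have hstay := mem_subtree_of_unsighted hG hs hlk hx hv hvl hiv hun
    obtain ⟨D₁, D₂, hD⟩ := List.append_of_mem (mem_descendants.mpr ⟨hv, hvl⟩)
    set A := D₁.flatMap (traversal G o l n (u :: st))
    set B := D₂.flatMap (traversal G o l n (u :: st))
    set M := traversal G o l n (u :: st) v with hM
    have hLeq : L = (u :: st) :: (A ++ (M ++ B)) := by
      rw [hL, traversal, hD, List.flatMap_append, List.flatMap_cons]
    have hlen : L.length = 1 + A.length + M.length + B.length := by
      rw [hLeq]; simp; lia
    obtain ⟨b, hb, j, hjs, c, hc, h1, h2⟩ := ih (u :: st) v (fun t => x (s * (1 + A.length) + t))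
      (hx.shift _) (fun y hy => by
        have h1 := dist_add_of_mem_subtree hG.1 hy hv
        have h2 := hh y (mem_subtree_trans hG.1 hy hv)
        rw [add_mul, one_mul] at h2
        lia)
      (fun t ht => by
        refine (hstay _ ?_ ?_).1
        · have := Nat.le_mul_of_pos_right s (show 0 < 1 + A.length by lia)
          lia
        · calc s * (1 + A.length) + t < s * (1 + A.length) + s * M.length := by lia
            _ = s * (1 + A.length + M.length) := by ring
            _ ≤ s * L.length := Nat.mul_le_mul_left _ (by lia))
    have hb' : 1 + A.length + b < L.length := by rw [hlen]; lia
    have hget : L[1 + A.length + b] = M[b] := by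
      simp only [hLeq]
      rw [List.getElem_cons, dif_neg (by lia), List.getElem_append_right (by lia),
        List.getElem_append_left (by lia)]
      congr 1
      lia
    have hidx : s * (1 + A.length) + (s * b + j) = s * (1 + A.length + b) + j := by ring
    have h3 := hcon _ hb' j hjs c (by rw [hget]; exact hc)
    rw [← hidx] at h3
    exact absurd h2 (h3 h1).not_ge

/-- Belief sets `A ∪ Y`, where `Y` consists of the positions in the subtree of `w` not yet swept:
if every course in that subtree starting in `Y` is sighted within `N` rounds, then the problem
reduces to `A` and to the subtrees in which the robber may be sighted. The parent `v` of `w` is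
probed in all rounds, so that the robber cannot change between `A` and the subtree of `w`. -/
theorem copsWin_union_of_sighting (hG : G.IsTree) {k m M : ℕ} (hm : 1 + 2 * M ≤ m)
    {v w : V} (hvw : G.Adj v w) (hd : G.dist o w = G.dist o v + 1)
    (hw : ∀ u ∈ subtree G o w, CopsWin G k m (subtree G o u))
    {A : Set V} (hvA : v ∈ A) (hreach : reach G (A \ {v}) ⊆ A) (hA : CopsWin G k m A)
    (N : ℕ) : ∀ (U : ℕ → List V) (Y : Set V), (∀ t, (U t).length ≤ M) →
      (∀ t, ∀ c ∈ U t, c ∈ subtree G o w) → Y ⊆ subtree G o w →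
      (∀ x, IsRobberCourse G x → x 0 ∈ Y → (∀ t < N, x t ∈ subtree G o w) →
        ∃ t < N, ∃ c ∈ U t, x t ∈ subtree G o c ∧ G.dist c (x t) ≤ k) →
      CopsWin G k m (A ∪ Y) := by
  classical
  have hpar : ∀ c, ∃ p, c ∈ subtree G o w → G.Adj p c ∧ G.dist o c = G.dist o p + 1 := by
    intro c
    by_cases hc : c ∈ subtree G o w
    · have hcv : c ∈ subtree G o v := mem_subtree_trans hG.1 hc (mem_subtree_of_adj hvw hd)
      obtain ⟨p, -, hp⟩ := exists_parent hG.1 hcv (by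
        rintro rfl
        rw [mem_subtree] at hc
        lia)
      exact ⟨p, fun _ => hp⟩
    · exact ⟨c, fun h => absurd h hc⟩
  choose par hpar using hpar
  induction N with
  | zero =>
    intro U Y _ _ _ hY
    refine hA.mono (Set.union_subset le_rfl fun y hy => ?_)
    obtain ⟨t, ht, -⟩ := hY (fun _ => y) (fun _ => Or.inl rfl) hy (by simp)
    lia
  | succ N ih =>
    intro U Y hUM hUw hYw hY
    let C : Finset V := insert v ((U 0).toFinset ∪ ((U 0).map par).toFinset)
    have hcard : C.card ≤ m := by
      have h1 := Finset.card_insert_le v ((U 0).toFinset ∪ ((U 0).map par).toFinset)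
      have h2 := Finset.card_union_le (U 0).toFinset ((U 0).map par).toFinset
      have h3 := (U 0).toFinset_card_le
      have h4 := ((U 0).map par).toFinset_card_le
      have h5 := hUM 0
      rw [List.length_map] at h4
      exact h1.trans (by lia)
    have hUC : ∀ c ∈ U 0, c ∈ C ∧ par c ∈ C := by
      intro c hc
      simp only [C, Finset.mem_insert, Finset.mem_union, List.mem_toFinset, List.mem_map]
      exact ⟨Or.inr (Or.inl hc), Or.inr (Or.inr ⟨c, hc, rfl⟩)⟩
    refine CopsWin.step_finset C ⟨v, Finset.mem_insert_self _ _⟩ hcard fun x hx hxC => ?_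
    by_cases hsight : ∃ c ∈ U 0, x ∈ subtree G o c ∧ G.dist c x ≤ k
    · obtain ⟨c, hc, hxc, hck⟩ := hsight
      refine (hw c (hUw 0 c hc)).mono (reach_subset_subtree hG ?_ ?_)
      · rintro y ⟨-, hyp, -⟩
        obtain ⟨hp, hpd⟩ := hpar c (hUw 0 c hc)
        exact mem_subtree_of_probe_eq hG hp hpd hxc hck (hyp c (hUC c hc).1)
          (hyp _ (hUC c hc).2)
      · rintro ⟨-, -, h⟩
        exact h (hUC c hc).1
    · refine (ih (fun t => U (t + 1)) {z | z ∈ subtree G o w ∧ ∃ y ∈ Y, (z = y ∨ G.Adj y z) ∧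
        ¬ ∃ c ∈ U 0, y ∈ subtree G o c ∧ G.dist c y ≤ k} (fun t => hUM _) (fun t => hUw _)
        (fun z hz => hz.1) ?_).mono ?_
      · rintro x' hx' ⟨-, y, hyY, hxy, hyun⟩ hxw
        obtain ⟨t, ht, c, hc, hxc, hck⟩ := hY (fun t => Nat.casesOn t y x')
          (by
            rintro (_ | t)
            · exact hxy
            · exact hx' t)
          hyY (by
            rintro (_ | t) ht
            · exact hYw hyY
            · exact hxw t (by lia))
        rcases t with _ | t
        · exact absurd ⟨c, hc, hxc, hck⟩ hyun
        · exact ⟨t, by lia, c, hc, hxc, hck⟩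
      · rintro z ⟨y, ⟨hyAY, hyp, hyC⟩, hyz⟩
        have hyv : y ≠ v := by
          rintro rfl
          exact hyC (Finset.mem_insert_self _ _)
        rcases hyAY with hyA | hyY
        · exact Or.inl (hreach ⟨y, ⟨hyA, hyv⟩, hyz⟩)
        have hyw := hYw hyY
        by_cases hzw : z ∈ subtree G o w
        · refine Or.inr ⟨hzw, y, hyY, hyz, ?_⟩
          rintro ⟨c, hc, hyc, hck⟩
          obtain ⟨hp, hpd⟩ := hpar c (hUw 0 c hc)
          have hxc := mem_subtree_of_probe_eq hG hp hpd hyc hck (hyp c (hUC c hc).1).symm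
            (hyp _ (hUC c hc).2).symm
          refine hsight ⟨c, hc, hxc, ?_⟩
          have := hyp c (hUC c hc).1
          rw [probe_eq hG.1, probe_eq hG.1, if_pos hck] at this
          split_ifs at this with h
          exact h
        · -- the only exit from the subtree of `w` is the edge from `w` to its parent `v`
          left
          rcases hyz with rfl | hyz
          · exact absurd hyw hzw
          have hyw' : y = w := by
            by_contra hne
            exact hzw (mem_subtree_of_adj_of_ne hG hyw hne hyz)
          subst hyw'
          rcases hG.dist_eq_dist_add_one_of_adj o hyz with h | h
          · rwa [parent_unique hG hyz.symm h hvw hd]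
          · exact absurd (mem_subtree_of_adj hyz h) hzw

/-- A whole subtree can be swept by `1 + 2 * M` cops if `M` bounds the number of the members of a
stack which are probed in the same round. -/
theorem copsWin_union_subtree [Finite V] (hG : G.IsTree) {k l s n m : ℕ} (hs : 1 ≤ s)
    (hlk : l + s ≤ k) (hm : 1 + 2 * ((n + 1) / s + 1) ≤ m)
    {v w : V} (hvw : G.Adj v w) (hd : G.dist o w = G.dist o v + 1)
    (hh : ∀ y ∈ subtree G o w, G.dist w y < (n + 1) * l)
    (hw : ∀ u ∈ subtree G o w, CopsWin G k m (subtree G o u))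
    {A : Set V} (hvA : v ∈ A) (hreach : reach G (A \ {v}) ⊆ A) (hA : CopsWin G k m A) :
    CopsWin G k m (A ∪ subtree G o w) := by
  set L := traversal G o l n [] w with hL
  refine copsWin_union_of_sighting hG hm hvw hd hw hvA hreach hA (s * L.length)
    (fun t => residueClass s (t % s) (L.getD (t / s) [])) _ ?_ ?_ le_rfl ?_
  · intro t
    refine (length_residueClass_le (Nat.mod_lt _ hs) _).trans ?_
    gcongr
    rcases lt_or_ge (t / s) L.length with h | h
    · rw [List.getD_eq_getElem _ _ h]
      simpa using length_le_of_mem_traversal (List.getElem_mem h)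
    · rw [List.getD_eq_default _ _ h]
      simp
  · intro t c hc
    have hc := mem_of_mem_residueClass hc
    rcases lt_or_ge (t / s) L.length with h | h
    · rw [List.getD_eq_getElem _ _ h] at hc
      exact mem_subtree_of_mem_traversal hG.1 mem_subtree_self (by simp) (List.getElem_mem h) hc
    · rw [List.getD_eq_default _ _ h] at hc
      simp at hc
  · intro x hx _ hxw
    obtain ⟨b, hb, j, hj, c, hc, h⟩ := exists_sighting hG hs hlk n [] w x hx hh hxw
    refine ⟨s * b + j, ?_, c, ?_, h⟩
    · calc s * b + j < s * (b + 1) := by rw [mul_add]; lia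
        _ ≤ s * L.length := Nat.mul_le_mul_left _ hb
    · have h1 : (s * b + j) % s = j := by rw [Nat.mul_add_mod, Nat.mod_eq_of_lt hj]
      have h2 : (s * b + j) / s = b := by
        rw [Nat.mul_add_div hs, Nat.div_eq_of_lt hj, add_zero]
      rw [h1, h2, List.getD_eq_getElem _ _ hb]
      exact hc

/-- The cops win if the robber is in the subtree of `v`, by induction on the height of this subtree
and on the set `W` of the children of `v` whose subtrees have not been swept yet. -/
theorem copsWin_subtree [Finite V] (hG : G.IsTree) {k l s n m : ℕ} (hs : 1 ≤ s)
    (hlk : l + s ≤ k) (hm : 1 + 2 * ((n + 1) / s + 1) ≤ m)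
    (hh : ∀ y, G.dist o y < (n + 1) * l) (v : V) : CopsWin G k m (subtree G o v) := by
  classical
  induction hN : (n + 1) * l - G.dist o v using Nat.strong_induction_on generalizing v with
  | _ N ih =>
  have hv := hh v
  have hdeep : ∀ u, G.dist o v < G.dist o u → CopsWin G k m (subtree G o u) := fun u hu =>
    ih _ (by lia) u rfl
  have key : ∀ W : Finset V, (∀ w ∈ W, G.Adj v w ∧ G.dist o w = G.dist o v + 1) →
      CopsWin G k m (insert v (⋃ w ∈ W, subtree G o w)) := by
    intro W
    induction W using Finset.induction_on with
    | empty =>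
      intro _
      refine CopsWin.step_finset {v} (by simp) (by simp; lia) fun x hx hxv => ?_
      simp at hx hxv
      exact absurd hx hxv
    | insert w W _ ihW =>
      intro hW
      have hW' := fun z hz => hW z (Finset.mem_insert_of_mem hz)
      obtain ⟨hvw, hd⟩ := hW w (Finset.mem_insert_self _ _)
      refine (copsWin_union_subtree hG hs hlk hm hvw hd ?_ ?_ (A := insert v _)
        (Set.mem_insert _ _) ?_ (ihW hW')).mono ?_
      · intro y hy
        have := hh y
        rw [mem_subtree] at hy
        lia
      · intro u hu
        rw [mem_subtree] at hu
        exact hdeep u (by lia)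
      · rintro z ⟨y, ⟨hy, hyv⟩, hyz⟩
        rcases hy with hy | hy
        · exact absurd hy hyv
        simp only [Set.mem_iUnion] at hy
        obtain ⟨a, ha, hya⟩ := hy
        obtain ⟨hva, hda⟩ := hW' a ha
        by_cases hza : z ∈ subtree G o a
        · exact Or.inr (Set.mem_biUnion (Finset.mem_coe.2 ha) hza)
        left
        rcases hyz with rfl | hyz
        · exact absurd hya hza
        have hyw' : y = a := by
          by_contra hne
          exact hza (mem_subtree_of_adj_of_ne hG hya hne hyz)
        subst hyw'
        rcases hG.dist_eq_dist_add_one_of_adj o hyz with h | h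
        · exact parent_unique hG hyz.symm h hva hda
        · exact absurd (mem_subtree_of_adj hyz h) hza
      · rintro z (rfl | hz)
        · exact Or.inl (Set.mem_insert _ _)
        · simp only [Set.mem_iUnion, Finset.mem_insert] at hz
          obtain ⟨a, rfl | ha, hz⟩ := hz
          · exact Or.inr hz
          · exact Or.inl (Or.inr (Set.mem_biUnion (Finset.mem_coe.2 ha) hz))
  refine (key (Set.toFinite {w | G.Adj v w ∧ G.dist o w = G.dist o v + 1}).toFinset
    (by simp)).mono fun x hx => ?_
  by_cases hxv : x = v
  · exact Or.inl hxv
  right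
  obtain ⟨w, hw, hvw, hxw⟩ := exists_mem_subtree_of_le_dist hG.1 hx (l := 1)
    (hG.1.pos_dist_of_ne (Ne.symm hxv))
  simp only [Set.mem_iUnion]
  refine ⟨w, ?_, hxw⟩
  rw [mem_subtree, hvw] at hw
  simp only [Set.Finite.mem_toFinset]
  exact ⟨SimpleGraph.dist_eq_one_iff_adj.mp hvw, hw.symm⟩

end Sweep

/-! ### The upper bound -/

/-- Rooted at a center, a tree of radius `R` is traversed in steps of length `k / 2`, so that a
stack has about `2 * R / k` members, each of which needs a probe every `k / 2` rounds only. -/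
theorem zeta_le_of_isTree [Finite V] {G : SimpleGraph V} (hG : G.IsTree) {k : ℕ} (hk : 2 ≤ k) :
    zeta k G ≤ 1 + 2 * ((natRadius G / (k / 2) + 1) / (k / 2) + 1) := by
  have : Nonempty V := hG.1.nonempty
  obtain ⟨o, ho⟩ := G.exists_eccent_eq_radius
  have hne : G.radius ≠ ⊤ := SimpleGraph.radius_ne_top_iff.mpr hG.1
  have hR : ∀ y, G.dist o y ≤ natRadius G := by
    intro y
    have h : G.edist o y ≤ G.radius := ho ▸ SimpleGraph.edist_le_eccent
    exact ENat.toNat_le_toNat h hne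
  have hl : 1 ≤ k / 2 := by lia
  refine zeta_le_of_copsWin (by lia) ((copsWin_subtree hG (o := o) (l := k / 2) (s := k / 2)
    (n := natRadius G / (k / 2)) hl (by lia) le_rfl (fun y => ?_) o).mono
    fun x _ => mem_subtree_root)
  exact (hR y).trans_lt (Nat.lt_mul_of_div_lt (Nat.lt_succ_self _) hl)

/-- If `√R ≤ C * f R`, then the number of cops is eventually bounded in terms of `C ^ 2`. -/
theorem exists_limsup_zeta_le (V : ℕ → Type u) [∀ n, Finite (V n)] (T : ∀ n, SimpleGraph (V n))
    (hT : ∀ n, (T n).IsTree) (hrad : Tendsto (fun n => natRadius (T n)) atTop atTop)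
    (f : ℝ → ℝ) (hf : ∀ x, 0 ≤ x → 0 ≤ f x)
    (hO : (fun n : ℕ => √(n : ℝ)) =O[atTop] (fun n : ℕ => f n)) :
    ∃ d : ℕ, limsup (fun n => (zeta ⌊f (natRadius (T n))⌋₊ (T n) : ℕ∞)) atTop ≤ d := by
  obtain ⟨C, hC, hCf⟩ := hO.exists_pos
  rw [isBigOWith_iff] at hCf
  have hlarge : Tendsto (fun n : ℕ => √(n : ℝ)) atTop atTop :=
    Real.tendsto_sqrt_atTop.comp tendsto_natCast_atTop_atTop
  set N := ⌈16 * C ^ 2⌉₊ with hN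
  refine ⟨1 + 2 * (N + 2), limsup_le_of_le (by isBoundedDefault) ?_⟩
  filter_upwards [hrad.eventually (hCf.and (hlarge.eventually_ge_atTop (4 * C)))] with n hn
  obtain ⟨h1, h2⟩ := hn
  set R := natRadius (T n)
  rw [Real.norm_of_nonneg (Real.sqrt_nonneg _),
    Real.norm_of_nonneg (hf _ (Nat.cast_nonneg _))] at h1
  set k := ⌊f R⌋₊ with hk
  have hfk : f R < k + 1 := Nat.lt_floor_add_one _
  have h3 : √(R : ℝ) ≤ C * (k + 1) := h1.trans (mul_le_mul_of_nonneg_left hfk.le hC.le)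
  have hk3 : 3 ≤ k := by
    have : (4 : ℝ) ≤ k + 1 := by
      rw [← mul_le_mul_iff_right₀ hC]
      linarith
    exact_mod_cast (by linarith : (3 : ℝ) ≤ k)
  have hkl : k + 1 ≤ 4 * (k / 2) := by lia
  have hkl' : (k : ℝ) + 1 ≤ 4 * ((k / 2 : ℕ) : ℝ) := by exact_mod_cast hkl
  have h4 : √(R : ℝ) ≤ C * (4 * ((k / 2 : ℕ) : ℝ)) :=
    h3.trans (mul_le_mul_of_nonneg_left hkl' hC.le)
  have h5 : (R : ℝ) ≤ N * (((k / 2 : ℕ) : ℝ) * ((k / 2 : ℕ) : ℝ)) := by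
    calc (R : ℝ) = √(R : ℝ) ^ 2 := (Real.sq_sqrt (Nat.cast_nonneg _)).symm
      _ ≤ (C * (4 * ((k / 2 : ℕ) : ℝ))) ^ 2 := by gcongr
      _ = 16 * C ^ 2 * (((k / 2 : ℕ) : ℝ) * ((k / 2 : ℕ) : ℝ)) := by ring
      _ ≤ N * (((k / 2 : ℕ) : ℝ) * ((k / 2 : ℕ) : ℝ)) := by
        gcongr
        exact Nat.le_ceil _
  have h6 : R ≤ k / 2 * (k / 2) * N := by
    rw [mul_comm]
    exact_mod_cast h5
  have h7 : R / (k / 2) / (k / 2) ≤ N := by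
    rw [Nat.div_div_eq_div_mul]
    exact Nat.div_le_of_le_mul h6
  have h8 : (R / (k / 2) + 1) / (k / 2) ≤ N + 1 := by
    calc (R / (k / 2) + 1) / (k / 2) ≤ (R / (k / 2) + k / 2) / (k / 2) := by gcongr; lia
      _ = R / (k / 2) / (k / 2) + 1 := Nat.add_div_right _ (by lia)
      _ ≤ N + 1 := by lia
  exact_mod_cast (zeta_le_of_isTree (hT n) (by lia : 2 ≤ k)).trans (by lia)

/-! ### Complete regular rooted trees -/

/-- The vertices of the complete `D`-ary tree of height `r`: words of length at most `r`. The root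
is the empty word, the parent of a word is its tail, and a word lies below its suffixes. -/
abbrev Word (D r : ℕ) : Type := {x : List (Fin D) // x.length ≤ r}

/-- The complete `D`-ary tree of height `r`. -/
def regularTree (D r : ℕ) : SimpleGraph (Word D r) where
  Adj x y := (∃ a, x.1 = a :: y.1) ∨ ∃ a, y.1 = a :: x.1
  symm := ⟨fun _ _ h => h.symm⟩
  loopless := ⟨fun x h => by rcases h with ⟨a, h⟩ | ⟨a, h⟩ <;> simp at h⟩

section RegularTree

variable {D r : ℕ}

instance : Finite (Word D r) := List.finite_length_le (Fin D) r

theorem exists_descending_walk (x : Word D r) : ∀ y : Word D r, x.1 <:+ y.1 →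
    ∃ W : (regularTree D r).Walk y x, W.length + x.1.length = y.1.length ∧
      ∀ z ∈ W.support, x.1 <:+ z.1 ∧ z.1 <:+ y.1 := by
  rintro ⟨l, hl⟩
  induction l with
  | nil =>
    intro h
    obtain rfl : x = ⟨[], hl⟩ := Subtype.ext (List.suffix_nil.mp h)
    exact ⟨.nil, by simp⟩
  | cons a l ih =>
    intro h
    rcases List.suffix_cons_iff.mp h with h | h
    · obtain rfl : x = ⟨a :: l, hl⟩ := Subtype.ext h
      exact ⟨.nil, by simp⟩
    · have hl' : l.length ≤ r := by simp at hl; lia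
      obtain ⟨W, hW, hs⟩ := ih hl' h
      have hadj : (regularTree D r).Adj ⟨a :: l, hl⟩ ⟨l, hl'⟩ := Or.inl ⟨a, rfl⟩
      refine ⟨.cons hadj W, by simp at hW ⊢; lia, ?_⟩
      intro z hz
      rw [SimpleGraph.Walk.support_cons, List.mem_cons] at hz
      rcases hz with rfl | hz
      · exact ⟨h.trans (List.suffix_cons _ _), List.suffix_rfl⟩
      · exact ⟨(hs z hz).1, (hs z hz).2.trans (List.suffix_cons _ _)⟩

/-- Two vertices below `x` are joined by a walk below `x`, through `x`. -/
theorem exists_walk_below (x y z : Word D r) (hy : x.1 <:+ y.1) (hz : x.1 <:+ z.1) :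
    ∃ W : (regularTree D r).Walk y z, W.length + 2 * x.1.length = y.1.length + z.1.length ∧
      ∀ a ∈ W.support, x.1 <:+ a.1 ∧ (a.1 <:+ y.1 ∨ a.1 <:+ z.1) := by
  obtain ⟨W₁, h₁, hs₁⟩ := exists_descending_walk x y hy
  obtain ⟨W₂, h₂, hs₂⟩ := exists_descending_walk x z hz
  refine ⟨W₁.append W₂.reverse, ?_, fun a ha => ?_⟩
  · rw [SimpleGraph.Walk.length_append, SimpleGraph.Walk.length_reverse]
    lia
  · rw [SimpleGraph.Walk.mem_support_append_iff, SimpleGraph.Walk.support_reverse,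
      List.mem_reverse] at ha
    rcases ha with ha | ha
    · exact ⟨(hs₁ a ha).1, Or.inl (hs₁ a ha).2⟩
    · exact ⟨(hs₂ a ha).1, Or.inr (hs₂ a ha).2⟩

theorem edist_root_le (x : Word D r) :
    (regularTree D r).edist ⟨[], Nat.zero_le _⟩ x ≤ r := by
  obtain ⟨W, hW, -⟩ := exists_descending_walk ⟨[], Nat.zero_le _⟩ x (List.nil_suffix)
  refine (SimpleGraph.edist_le W.reverse).trans ?_
  have := x.2
  rw [SimpleGraph.Walk.length_reverse]
  simp at hW
  exact_mod_cast (by lia : W.length ≤ r)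

theorem regularTree_connected : (regularTree D r).Connected := by
  have : Nonempty (Word D r) := ⟨⟨[], Nat.zero_le _⟩⟩
  refine ⟨fun x y => ?_⟩
  obtain ⟨W, -⟩ := exists_walk_below ⟨[], Nat.zero_le _⟩ x y List.nil_suffix List.nil_suffix
  exact W.reachable

theorem regularTree_isTree : (regularTree D r).IsTree := by
  refine ⟨regularTree_connected, SimpleGraph.isAcyclic_iff_forall_adj_isBridge.mpr ?_⟩
  -- without the edge from `v` to its parent, the words with suffix `v` are closed under adjacency
  have key : ∀ v w : Word D r, ∀ a, v.1 = a :: w.1 →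
      (regularTree D r).IsBridge s(v, w) := by
    intro v w a hvw
    rw [SimpleGraph.isBridge_iff]
    rintro ⟨W⟩
    have hcl : ∀ {x y : Word D r}
        (W : ((regularTree D r) \ SimpleGraph.fromEdgeSet {s(v, w)}).Walk x y),
        v.1 <:+ x.1 → v.1 <:+ y.1 := by
      intro x y W
      induction W with
      | nil => exact id
      | @cons x z y h W ih =>
        refine fun hx => ih ?_
        rw [SimpleGraph.sdiff_adj] at h
        obtain ⟨⟨b, hb⟩ | ⟨b, hb⟩, hne⟩ := h
        · rw [hb] at hx
          rcases List.suffix_cons_iff.mp hx with hv | hv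
          · exfalso
            have h1 : v = x := Subtype.ext (hv.trans hb.symm)
            have h2 : w = z := by
              rw [hvw] at hv
              exact Subtype.ext (List.cons.inj hv).2
            apply hne
            rw [SimpleGraph.fromEdgeSet_adj, ← h1, ← h2]
            refine ⟨rfl, fun h => ?_⟩
            rw [h] at hvw
            simp at hvw
          · exact hv
        · rw [hb]
          exact hx.trans (List.suffix_cons _ _)
    have h := (hcl W List.suffix_rfl).length_le
    rw [hvw, List.length_cons] at h
    lia
  rintro v w (⟨a, h⟩ | ⟨a, h⟩)
  · exact key v w a h
  · rw [Sym2.eq_swap]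
    exact key w v a h

/-- A function that changes by at most `1` along edges is `1`-Lipschitz. -/
theorem le_add_of_edist_le {G : SimpleGraph V} {g : V → ℕ}
    (hg : ∀ x y, G.Adj x y → g x ≤ g y + 1) {x y : V} {n : ℕ} (h : G.edist x y ≤ n) :
    g x ≤ g y + n := by
  obtain ⟨W, hW⟩ := SimpleGraph.exists_walk_of_edist_ne_top (ne_top_of_le_ne_top (by simp) h)
  rw [← hW] at h
  have h : W.length ≤ n := by exact_mod_cast h
  suffices ∀ {x y : V} (W : G.Walk x y), g x ≤ g y + W.length from (this W).trans (by lia)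
  intro x y W
  induction W with
  | nil => simp
  | cons h W ih =>
    have := hg _ _ h
    rw [SimpleGraph.Walk.length_cons]
    lia

theorem length_le_add_of_edist_le {x y : Word D r} {n : ℕ}
    (h : (regularTree D r).edist x y ≤ n) : x.1.length ≤ y.1.length + n := by
  refine le_add_of_edist_le (g := fun x : Word D r => x.1.length) ?_ h
  rintro x y (⟨a, h⟩ | ⟨a, h⟩) <;> simp only [h, List.length_cons] <;> lia

/-- Below `a :: v`, the depth relative to `v` bounds from below the distance from the complement
of this branch. -/
theorem length_le_add_of_edist_le_of_not_suffix {a : Fin D} {v : List (Fin D)} {x c : Word D r}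
    {n : ℕ} (h : (regularTree D r).edist c x ≤ n) (hx : a :: v <:+ x.1) (hc : ¬ a :: v <:+ c.1) :
    x.1.length ≤ v.length + n := by
  classical
  rw [SimpleGraph.edist_comm] at h
  have key := le_add_of_edist_le
    (g := fun x : Word D r => if a :: v <:+ x.1 then x.1.length - v.length else 0) (by
      have hcons : ∀ (b : Fin D) (y : List (Fin D)),
          (if a :: v <:+ b :: y then (b :: y).length - v.length else 0) ≤
            (if a :: v <:+ y then y.length - v.length else 0) + 1 ∧
          (if a :: v <:+ y then y.length - v.length else 0) ≤
            (if a :: v <:+ b :: y then (b :: y).length - v.length else 0) := by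
        intro b y
        by_cases h1 : a :: v <:+ y
        · have h2 : a :: v <:+ b :: y := h1.trans (List.suffix_cons _ _)
          rw [if_pos h1, if_pos h2, List.length_cons]
          lia
        · rw [if_neg h1]
          split_ifs with h2
          · rcases List.suffix_cons_iff.mp h2 with h3 | h3
            · rw [← h3, List.length_cons]
              lia
            · exact absurd h3 h1
          · lia
      rintro x y (⟨b, h⟩ | ⟨b, h⟩)
      · simp only [h]
        exact (hcons b y.1).1
      · simp only [h]
        exact (hcons b x.1).2.trans (Nat.le_succ _)) h
  simp only [if_pos hx, if_neg hc] at key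
  lia

/-- A branch at `v` is entered through `v`. -/
theorem edist_le_of_not_suffix {a : Fin D} {v x c : Word D r} {n : ℕ}
    (h : (regularTree D r).edist c x ≤ n) (hx : a :: v.1 <:+ x.1) (hc : ¬ a :: v.1 <:+ c.1) :
    (regularTree D r).edist c v ≤ n := by
  obtain ⟨W, hW⟩ := SimpleGraph.exists_walk_of_edist_ne_top (ne_top_of_le_ne_top (by simp) h)
  refine le_trans ?_ (hW.trans_le h)
  clear hW h
  induction W with
  | nil => exact absurd hx hc
  | @cons c c' x h W ih =>
    by_cases hc' : a :: v.1 <:+ c'.1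
    · have hcv : c = v := by
        rcases h with ⟨b, h⟩ | ⟨b, h⟩
        · exact absurd (h ▸ hc'.trans (List.suffix_cons _ _)) hc
        · rw [h] at hc'
          rcases List.suffix_cons_iff.mp hc' with h1 | h1
          · exact Subtype.ext (List.cons.inj h1).2.symm
          · exact absurd h1 hc
      simp [hcv]
    · refine SimpleGraph.edist_triangle.trans (?_ : _ + (regularTree D r).edist c' v ≤ _)
      rw [SimpleGraph.edist_eq_one_iff_adj.mpr h, SimpleGraph.Walk.length_cons, Nat.cast_add,
        add_comm, Nat.cast_one]
      gcongr
      exact ih hx hc'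

/-- The root has eccentricity `r`, and every vertex avoids some branch at the root, whose leaves
have distance at least `r` from it. -/
theorem natRadius_regularTree (hD : 2 ≤ D) : natRadius (regularTree D r) = r := by
  have h1 : (regularTree D r).radius ≤ r :=
    SimpleGraph.radius_le_eccent.trans ((SimpleGraph.eccent_le_iff _ _).mpr edist_root_le)
  have h2 : (r : ℕ∞) ≤ (regularTree D r).radius := by
    refine le_iInf fun u => ?_
    -- a leaf in a branch at the root that does not contain `u`
    obtain ⟨a, ha⟩ : ∃ a : Fin D, ¬ [a] <:+ u.1 := by
      by_contra! h
      have h0 := List.suffix_of_suffix_length_le (h ⟨0, by lia⟩) (h ⟨1, by lia⟩) (by simp)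
      have := h0.eq_of_length (by simp)
      simp at this
    rcases Nat.eq_zero_or_pos r with rfl | hr
    · simp
    refine le_trans ?_ (SimpleGraph.edist_le_eccent (u := u)
      (v := (⟨List.replicate r a, by simp⟩ : Word D r)))
    by_contra! hlt
    obtain ⟨n, hn⟩ := ENat.ne_top_iff_exists.mp hlt.ne_top
    rw [← hn] at hlt
    have h3 := length_le_add_of_edist_le_of_not_suffix hn.ge (a := a) (v := [])
      (by
        refine ⟨List.replicate (r - 1) a, ?_⟩
        rw [← List.replicate_succ', Nat.sub_add_cancel hr]) ha
    have h4 : n < r := by exact_mod_cast hlt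
    simp at h3
    lia
  rw [natRadius, le_antisymm h1 h2, ENat.toNat_natCast]

end RegularTree

/-! ### Unseen robbers -/

/-- The vertex `x` is out of sight of all the cops on `u`. -/
def Unseen (G : SimpleGraph V) (k : ℕ) {m : ℕ} (u : Fin m → V) (x : V) : Prop :=
  ∀ i, ¬ G.edist (u i) x ≤ k

/-- The possible positions of a robber who has not been seen in the rounds `0, …, t`, the cops
being placed on `p s` in round `s`. -/
def unseenSet (G : SimpleGraph V) (k : ℕ) {m : ℕ} (p : ℕ → Fin m → V) : ℕ → Set V
  | 0 => {x | Unseen G k (p 0) x}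
  | t + 1 => {x | Unseen G k (p (t + 1)) x ∧ x ∈ reach G (unseenSet G k p t)}

section Unseen

variable {G : SimpleGraph V} {k m : ℕ} {p : ℕ → Fin m → V}

theorem exists_course_of_mem_unseenSet {t : ℕ} {x : V} (hx : x ∈ unseenSet G k p t) :
    ∃ y, IsRobberCourse G y ∧ (∀ s ≤ t, Unseen G k (p s) (y s)) ∧ y t = x := by
  induction t generalizing x with
  | zero =>
    refine ⟨fun _ => x, fun _ => Or.inl rfl, fun s hs => ?_, rfl⟩
    obtain rfl := Nat.le_zero.mp hs
    exact hx
  | succ t ih =>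
    obtain ⟨hun, z, hz, hxz⟩ := hx
    obtain ⟨y, hy, hys, rfl⟩ := ih hz
    refine ⟨fun s => if s ≤ t then y s else x, fun s => ?_, fun s hs => ?_, by simp⟩
    · rcases lt_trichotomy s t with h | rfl | h
      · simpa [h.le, Nat.succ_le_of_lt h] using hy s
      · simpa using hxz
      · simp [h.not_ge, (h.trans (Nat.lt_succ_self s)).not_ge]
    · dsimp only
      split_ifs with h
      · exact hys s h
      · obtain rfl : s = t + 1 := by lia
        exact hun

/-- If the robber can remain unseen for any finite time, then also forever, by compactness. -/
theorem exists_unseen_course [Finite V] (h : ∀ t, (unseenSet G k p t).Nonempty) :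
    ∃ x, IsRobberCourse G x ∧ ∀ t, Unseen G k (p t) (x t) := by
  let _ : TopologicalSpace V := ⊥
  have : DiscreteTopology V := ⟨rfl⟩
  let Z : ℕ → Set (ℕ → V) := fun t => {x | IsRobberCourse G x ∧ ∀ s ≤ t, Unseen G k (p s) (x s)}
  have hclosed : ∀ t, IsClosed (Z t) := by
    intro t
    have hZ : Z t = (⋂ s, (fun x : ℕ → V => (x s, x (s + 1))) ⁻¹'
        {q | q.2 = q.1 ∨ G.Adj q.1 q.2}) ∩
        ⋂ s, ⋂ _ : s ≤ t, (fun x : ℕ → V => x s) ⁻¹' {v | Unseen G k (p s) v} := by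
      ext x
      simp [Z, IsRobberCourse]
    rw [hZ]
    refine (isClosed_iInter fun s => ?_).inter
      (isClosed_iInter fun s => isClosed_iInter fun _ => ?_)
    · exact (isClosed_discrete _).preimage (by fun_prop)
    · exact (isClosed_discrete _).preimage (by fun_prop)
  obtain ⟨x, hx⟩ := IsCompact.nonempty_iInter_of_sequence_nonempty_isCompact_isClosed Z
    (fun t x hx => ⟨hx.1, fun s hs => hx.2 s (hs.trans (Nat.le_succ t))⟩)
    (fun t => by
      obtain ⟨x, hx⟩ := h t
      obtain ⟨y, hy, hys, -⟩ := exists_course_of_mem_unseenSet hx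
      exact ⟨y, hy, hys⟩)
    (hclosed 0).isCompact hclosed
  rw [Set.mem_iInter] at hx
  exact ⟨x, (hx 0).1, fun t => (hx t).2 t le_rfl⟩

theorem distVector_of_unseen {u : Fin m → V} {x : V} (h : Unseen G k u x) :
    distVector G k u x = fun _ => none :=
  funext fun i => if_neg (h i)

/-- As long as the robber is not seen, the cops' placements are those of the strategy after empty
answers, independently of the course. -/
theorem history_of_unseen {σ : CopStrategy V m} {y : ℕ → V} {t : ℕ}
    (h : ∀ s < t, Unseen G k (σ (List.replicate s fun _ => none)) (y s)) :
    history G k σ y t = List.replicate t fun _ => none := by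
  induction t with
  | zero => rfl
  | succ t ih =>
    rw [history, ih fun s hs => h s (hs.trans (Nat.lt_succ_self t)),
      distVector_of_unseen (h t (Nat.lt_succ_self t)), ← List.replicate_succ']

/-- If for all sequences of placements a robber who is never seen always has two possible
positions, then no strategy is winning. -/
theorem not_isWinning_of_nontrivial_unseenSet [Finite V]
    (h : ∀ (p : ℕ → Fin m → V) (t : ℕ), (unseenSet G k p t).Nontrivial) (σ : CopStrategy V m) :
    ¬ IsWinning G k σ := by
  intro hσ
  set p : ℕ → Fin m → V := fun t => σ (List.replicate t fun _ => none) with hp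
  obtain ⟨x, hx, hxun⟩ := exists_unseen_course (G := G) (k := k) fun t => (h p t).nonempty
  obtain ⟨t, v, hv⟩ := hσ x hx
  have hsub : unseenSet G k p t ⊆ candidates G k σ x t := by
    intro z hz
    obtain ⟨y, hy, hyun, hyz⟩ := exists_course_of_mem_unseenSet hz
    refine ⟨y, hy, ?_, hyz⟩
    rw [history_of_unseen fun s hs => hyun s (Nat.le_of_lt_succ hs),
      history_of_unseen fun s _ => hxun s]
  have := (h p t).mono hsub
  rw [hv] at this
  exact Set.not_nontrivial_singleton this

/-- A robber can move along a walk of vertices out of sight. -/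
theorem mem_unseenSet_of_walk {B : Set V} {b : ℕ} {x y : V} (W : G.Walk x y) {a : ℕ}
    (hB : ∀ z ∈ B, ∀ t ∈ Finset.Ioc a b, Unseen G k (p t) z) (hW : ∀ z ∈ W.support, z ∈ B)
    (hlen : a + W.length ≤ b) (hx : x ∈ unseenSet G k p a) : y ∈ unseenSet G k p b := by
  induction W generalizing a with
  | @nil x =>
    have hab : a ≤ b := hlen
    clear hlen
    induction b, hab using Nat.le_induction with
    | base => exact hx
    | succ b hab ih =>
      refine ⟨hB x (hW x (by simp)) _ (by simp; lia), x, ih fun z hz t ht => hB z hz t ?_,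
        Or.inl rfl⟩
      simp only [Finset.mem_Ioc] at ht ⊢
      lia
  | @cons x z y h W ih =>
    rw [SimpleGraph.Walk.length_cons] at hlen
    refine ih (a := a + 1) (fun z hz t ht => hB z hz t ?_) (fun v hv => hW v ?_) (by lia)
      ⟨hB z (hW z ?_) _ (by simp; lia), x, hx, Or.inr h⟩
    · simp only [Finset.mem_Ioc] at ht ⊢
      lia
    · simp [hv]
    · simp

end Unseen

/-! ### Evasion in regular trees -/

section Evasion

variable {D r k m : ℕ} {p : ℕ → Fin m → Word D r}

/-- The vertices below `v`. -/
def below (v : Word D r) : Set (Word D r) := {x | v.1 <:+ x.1}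

open Classical in
/-- The pairs of a round in `(a, b]` and a cop who is placed in `Z` in that round. -/
noncomputable def visits (p : ℕ → Fin m → V) (Z : Set V) (a b : ℕ) : Finset (ℕ × Fin m) :=
  (Finset.Ioc a b ×ˢ Finset.univ).filter fun q => p q.1 q.2 ∈ Z

theorem mem_visits {p : ℕ → Fin m → V} {Z : Set V} {a b : ℕ} {q : ℕ × Fin m} :
    q ∈ visits p Z a b ↔ q.1 ∈ Finset.Ioc a b ∧ p q.1 q.2 ∈ Z := by
  simp [visits]

theorem card_visits_le (p : ℕ → Fin m → V) (Z : Set V) (a b : ℕ) :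
    (visits p Z a b).card ≤ (b - a) * m := by
  classical
  refine (Finset.card_filter_le _ _).trans ?_
  rw [Finset.card_product, Nat.card_Ioc, Finset.card_univ, Fintype.card_fin]

/-- The positions from which a cop sees some vertex below `v`. -/
def watchZone (k : ℕ) (v : Word D r) : Set (Word D r) :=
  {c | ∃ x ∈ below v, (regularTree D r).edist c x ≤ k}

/-- No cop is placed in the branch of `v` belonging to the letter `i` in the rounds in `(a, b]`. -/
def Unvisited (p : ℕ → Fin m → Word D r) (v : Word D r) (a b : ℕ) (i : Fin D) : Prop :=
  ∀ t ∈ Finset.Ioc a b, ∀ c, ¬ i :: v.1 <:+ (p t c).1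

theorem Unvisited.mono {v : Word D r} {a b a' b' : ℕ} {i : Fin D} (h : Unvisited p v a b i)
    (ha : a ≤ a') (hb : b' ≤ b) : Unvisited p v a' b' i :=
  fun t ht => h t (Finset.Ioc_subset_Ioc ha hb ht)

theorem eq_of_cons_suffix {i j : Fin D} {v x : List (Fin D)} (hi : i :: v <:+ x)
    (hj : j :: v <:+ x) : i = j := by
  have h := (List.suffix_of_suffix_length_le hi hj (by simp)).eq_of_length (by simp)
  exact (List.cons.inj h).1

open Classical in
/-- The branches at `v` are disjoint, so that only few of them are visited in a short time. -/
theorem card_visited_le (p : ℕ → Fin m → Word D r) (v : Word D r) (a b : ℕ) :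
    (Finset.univ.filter fun i => ¬ Unvisited p v a b i).card ≤ (b - a) * m := by
  refine (Finset.card_le_card_of_forall_subsingleton (t := Finset.Ioc a b ×ˢ Finset.univ)
    (fun i q => i :: v.1 <:+ (p q.1 q.2).1) ?_ ?_).trans ?_
  · intro i hi
    have hi := (Finset.mem_filter.mp hi).2
    unfold Unvisited at hi
    push Not at hi
    obtain ⟨t, ht, c, hc⟩ := hi
    exact ⟨(t, c), by simpa using ht, hc⟩
  · rintro q - i ⟨-, hi⟩ j ⟨-, hj⟩
    exact eq_of_cons_suffix hi hj
  · rw [Finset.card_product, Nat.card_Ioc, Finset.card_univ, Fintype.card_fin]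

/-- The descendant of `v` reached by following the letter `i` for `K` steps. -/
def stem (v : Word D r) (K : ℕ) (h : v.1.length + K ≤ r) (i : Fin D) : Word D r :=
  ⟨List.replicate K i ++ v.1, by simp; lia⟩

section Stem

variable {v : Word D r} {K : ℕ} {hv : v.1.length + K ≤ r} {i j : Fin D} {a b : ℕ}

theorem length_stem : (stem v K hv i).1.length = v.1.length + K := by
  simp [stem, add_comm]

theorem cons_suffix_stem (hK : 0 < K) : i :: v.1 <:+ (stem v K hv i).1 := by
  obtain ⟨K, rfl⟩ := Nat.exists_eq_add_one.mpr hK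
  refine ⟨List.replicate K i, ?_⟩
  simp [stem, List.replicate_succ']

theorem below_stem_subset : below (stem v K hv i) ⊆ below v :=
  fun _ hx => (List.suffix_append _ _).trans hx

theorem eq_or_cons_suffix_of_suffix_stem (hK : 0 < K) {z : Word D r} (h1 : v.1 <:+ z.1)
    (h2 : z.1 <:+ (stem v K hv i).1) : z = v ∨ i :: v.1 <:+ z.1 := by
  rcases Nat.lt_or_ge v.1.length z.1.length with h | h
  · exact Or.inr (List.suffix_of_suffix_length_le (cons_suffix_stem hK) h2 (by simpa using h))
  · exact Or.inl (Subtype.ext (h1.eq_of_length_le h).symm)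

theorem cons_suffix_of_mem_watchZone (hK : k < K) {c : Word D r}
    (hc : c ∈ watchZone k (stem v K hv i)) : i :: v.1 <:+ c.1 := by
  obtain ⟨x, hx, hcx⟩ := hc
  by_contra hn
  have h1 := length_le_add_of_edist_le_of_not_suffix hcx
    ((cons_suffix_stem (by lia)).trans hx) hn
  have h2 := hx.length_le
  rw [length_stem] at h2
  lia

theorem unseen_of_unvisited (hK : k < K) (h : Unvisited p v a b i) :
    ∀ x ∈ below (stem v K hv i), ∀ t ∈ Finset.Ioc a b, Unseen (regularTree D r) k (p t) x :=
  fun x hx t ht c hc => h t ht c (cons_suffix_of_mem_watchZone hK ⟨x, hx, hc⟩)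

theorem below_stem_subset_of_subset (hK : k < K) (h : Unvisited p v a b i) (hab : a ≤ b)
    (hfull : below (stem v K hv i) ⊆ unseenSet (regularTree D r) k p a) :
    below (stem v K hv i) ⊆ unseenSet (regularTree D r) k p b :=
  fun x hx => mem_unseenSet_of_walk (.nil (u := x)) (unseen_of_unvisited hK h) (by simpa using hx)
    hab (hfull hx)

/-- If a branch is not visited for a long time and the robber may be deep in it at the beginning,
then the robber may be anywhere deep in it at the end. -/
theorem below_stem_subset_of_mem (hK : k < K) (h : Unvisited p v a b i) (hab : a + 2 * r ≤ b)
    {z : Word D r} (hz : z ∈ below (stem v K hv i))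
    (hza : z ∈ unseenSet (regularTree D r) k p a) :
    below (stem v K hv i) ⊆ unseenSet (regularTree D r) k p b := by
  intro x hx
  obtain ⟨W, hW, hs⟩ := exists_walk_below _ z x hz hx
  refine mem_unseenSet_of_walk W (unseen_of_unvisited hK h) (fun a ha => (hs a ha).1) ?_ hza
  have := z.2
  have := x.2
  lia

/-- If no cop guards `v` for `2 * K` rounds, then the robber may change from one unvisited branch
to any other. -/
theorem stem_mem_of_unguarded (hK : 0 < K) (hi : Unvisited p v a (a + 2 * K) i)
    (hj : Unvisited p v a (a + 2 * K) j)
    (hguard : ∀ t ∈ Finset.Ioc a (a + 2 * K), ∀ c, ¬ (regularTree D r).edist (p t c) v ≤ k)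
    (h : stem v K hv i ∈ unseenSet (regularTree D r) k p a) :
    stem v K hv j ∈ unseenSet (regularTree D r) k p (a + 2 * K) := by
  obtain ⟨W, hW, hs⟩ := exists_walk_below v (stem v K hv i) (stem v K hv j)
    (List.suffix_append _ _) (List.suffix_append _ _)
  refine mem_unseenSet_of_walk W
    (B := {z : Word D r | v.1 <:+ z.1 ∧ (z.1 <:+ (stem v K hv i).1 ∨ z.1 <:+ (stem v K hv j).1)}) ?_
    (fun z hz => hs z hz) ?_ h
  · have key : ∀ (l : Fin D) (z : Word D r), Unvisited p v a (a + 2 * K) l → v.1 <:+ z.1 →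
        z.1 <:+ (stem v K hv l).1 → ∀ t ∈ Finset.Ioc a (a + 2 * K),
        Unseen (regularTree D r) k (p t) z := by
      intro l z hl h1 h2 t ht c hc
      rcases eq_or_cons_suffix_of_suffix_stem hK h1 h2 with rfl | h3
      · exact hguard t ht c hc
      · exact hguard t ht c (edist_le_of_not_suffix hc h3 (hl t ht c))
    rintro z ⟨h1, h2 | h2⟩
    · exact key i z hi h1 h2
    · exact key j z hj h1 h2
  · rw [length_stem, length_stem] at hW
    lia

end Stem

/-- Cleaning the subtree of `v` completely, starting from a situation in which the robber may be
anywhere in it, requires many visits near this subtree within a short time: the number of visits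
grows linearly in the height. For the induction step, consider the last time at which almost all
the branches at `v` were contaminated, and the first branch to be cleaned after that. While it is
being cleaned, there are many visits to this branch, and there is at least one more visit, which
guards `v`; otherwise the robber could spread from an unvisited branch to almost all branches. -/
theorem exists_many_visits (hr : 0 < r) (hD : 1 + 4 * (m * (2 * k + 2 + r)) < D) (n : ℕ) :
    ∀ (v : Word D r) (t₀ t₁ : ℕ), v.1.length + n * (2 * k + 2) ≤ r →
      below v ⊆ unseenSet (regularTree D r) k p t₀ → t₀ ≤ t₁ →
      (∀ x ∈ below v, x ∉ unseenSet (regularTree D r) k p t₁) →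
      ∃ w, t₀ ≤ w ∧ w ≤ t₁ ∧
        n ≤ (visits p (watchZone k v) w (w + 2 * (2 * k + 2))).card := by
  classical
  set K := 2 * k + 2 with hKdef
  have hK : k < K := by lia
  induction n with
  | zero => exact fun v t₀ t₁ _ _ h _ => ⟨t₀, le_rfl, h, Nat.zero_le _⟩
  | succ n ih =>
    intro v t₀ t₁ hvr hfull ht hclean
    rw [add_mul, one_mul] at hvr
    have hv : v.1.length + K ≤ r := by lia
    set P := unseenSet (regularTree D r) k p
    let u : Fin D → Word D r := stem v K hv
    have huu : ∀ i, u i ∈ below (u i) := fun i => List.suffix_rfl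
    have huv : ∀ i, below (u i) ⊆ below v := fun i => below_stem_subset
    -- the last time at which almost all of the `u i` are contaminated
    obtain ⟨s, hs, hsmax⟩ := Finset.exists_max_image
      ((Finset.Icc t₀ t₁).filter fun t =>
        D ≤ (Finset.univ.filter fun i => u i ∈ P t).card + 2 * K * m) id
      ⟨t₀, by
        have : (Finset.univ.filter fun i => u i ∈ P t₀) = Finset.univ :=
          Finset.filter_true_of_mem fun i _ => hfull (huv i (huu i))
        rw [Finset.mem_filter, this, Finset.card_univ, Fintype.card_fin, Finset.mem_Icc]
        exact ⟨⟨le_rfl, ht⟩, Nat.le_add_right _ _⟩⟩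
    simp only [Finset.mem_filter, Finset.mem_Icc, id] at hs hsmax
    obtain ⟨⟨hs₀, hs₁⟩, hsD⟩ := hs
    -- the branches which are completely contaminated somewhat later
    set t₂ := s + 2 * r with ht₂
    set A := (Finset.univ.filter fun i => u i ∈ P s) \
      Finset.univ.filter fun i => ¬ Unvisited p v s t₂ i with hA
    have hAcard : D ≤ A.card + 2 * K * m + 2 * r * m := by
      have h1 := Finset.le_card_sdiff (Finset.univ.filter fun i => ¬ Unvisited p v s t₂ i)
        (Finset.univ.filter fun i => u i ∈ P s)
      have h2 := card_visited_le p v s t₂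
      rw [show t₂ - s = 2 * r by lia] at h2
      rw [hA]
      lia
    have hbig : 1 + (2 * r + 2 * K) * m < A.card := by
      have h1 : 4 * (m * (K + r)) = 2 * K * m + 2 * r * m + (2 * r + 2 * K) * m := by ring
      lia
    have hAmem : ∀ i ∈ A, u i ∈ P s ∧ Unvisited p v s t₂ i := by
      intro i hi
      simpa [hA] using hi
    have hAfull : ∀ i ∈ A, below (u i) ⊆ P t₂ := fun i hi =>
      below_stem_subset_of_mem hK (hAmem i hi).2 le_rfl (huu i) (hAmem i hi).1
    have hAne : A.Nonempty := Finset.card_pos.mp (by lia)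
    have ht₂₁ : t₂ ≤ t₁ := by
      by_contra! hlt
      obtain ⟨i, hi⟩ := hAne
      refine hclean (u i) (huv i (huu i)) (mem_unseenSet_of_walk (.nil (u := u i))
        (unseen_of_unvisited (hv := hv) hK ((hAmem i hi).2.mono le_rfl hlt.le)) ?_ hs₁ (hAmem i hi).1)
      simpa using huu i
    -- the first of these branches to be cleaned
    have hex : ∀ i, ∃ t, t₂ ≤ t ∧ ∀ x ∈ below (u i), x ∉ P t :=
      fun i => ⟨t₁, ht₂₁, fun x hx => hclean x (huv i hx)⟩
    let τ : Fin D → ℕ := fun i => Nat.find (hex i)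
    obtain ⟨i, hiA, himin⟩ := Finset.exists_min_image A τ hAne
    have hτ₁ : τ i ≤ t₁ := Nat.find_min' (hex i) ⟨ht₂₁, fun x hx => hclean x (huv i hx)⟩
    obtain ⟨w, hw₂, hwτ, hwcard⟩ := ih (u i) t₂ (τ i)
      (by rw [length_stem]; lia) (hAfull i hiA) (Nat.find_spec (hex i)).1
      (Nat.find_spec (hex i)).2
    refine ⟨w, by lia, by lia, ?_⟩
    -- another one of these branches which is not visited around the round `w`
    obtain ⟨j, hj⟩ : (A.erase i \ Finset.univ.filter
        fun i => ¬ Unvisited p v (w - 2 * r) (w + 2 * K) i).Nonempty := by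
      apply Finset.card_pos.mp
      have h1 := Finset.le_card_sdiff (Finset.univ.filter
        fun i => ¬ Unvisited p v (w - 2 * r) (w + 2 * K) i) (A.erase i)
      have h2 := card_visited_le p v (w - 2 * r) (w + 2 * K)
      have h3 : (w + 2 * K - (w - 2 * r)) * m ≤ (2 * r + 2 * K) * m :=
        Nat.mul_le_mul_right _ (by lia)
      rw [Finset.card_erase_of_mem hiA] at h1
      lia
    simp only [Finset.mem_sdiff, Finset.mem_erase, Finset.mem_filter, Finset.mem_univ, true_and,
      not_not] at hj
    obtain ⟨⟨-, hjA⟩, hjun⟩ := hj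
    have hjfull : below (u j) ⊆ P w := by
      rcases Nat.lt_or_ge w (t₂ + 2 * r) with hlt | hge
      · exact below_stem_subset_of_subset hK (hjun.mono (by lia) (by lia)) hw₂ (hAfull j hjA)
      · have hlt : w - 2 * r < τ j := by
          have := himin j hjA
          lia
        have := Nat.find_min (hex j) hlt
        push Not at this
        obtain ⟨z, hz, hzP⟩ := this (by lia)
        exact below_stem_subset_of_mem hK (hjun.mono le_rfl (by lia)) (by lia) hz hzP
    -- hence `v` is guarded
    obtain ⟨t, htw, c, hc⟩ : ∃ t ∈ Finset.Ioc w (w + 2 * K), ∃ c,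
        (regularTree D r).edist (p t c) v ≤ k := by
      by_contra! hguard
      rcases Nat.lt_or_ge t₁ (w + 2 * K) with hlt | hge
      · refine hclean (u j) (huv j (huu j)) (below_stem_subset_of_subset hK
          (hjun.mono (by lia) hlt.le) (by lia) hjfull (huu j))
      · have hmany : D ≤ (Finset.univ.filter fun l => u l ∈ P (w + 2 * K)).card + 2 * K * m := by
          have h1 := card_visited_le p v w (w + 2 * K)
          have h2 := Finset.card_filter_add_card_filter_not (s := Finset.univ)
            (fun l => Unvisited p v w (w + 2 * K) l)
          have h3 : (Finset.univ.filter fun l => Unvisited p v w (w + 2 * K) l).card ≤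
              (Finset.univ.filter fun l => u l ∈ P (w + 2 * K)).card := by
            refine Finset.card_le_card (Finset.monotone_filter_right _ fun l _ hl => ?_)
            exact stem_mem_of_unguarded (by lia) (hjun.mono (by lia) le_rfl) hl
              (fun t ht c => (hguard t ht c).not_ge) (hjfull (huu j))
          rw [Finset.card_univ, Fintype.card_fin] at h2
          rw [Nat.add_sub_cancel_left] at h1
          lia
        have := hsmax (w + 2 * K) ⟨⟨by lia, hge⟩, hmany⟩
        lia
    -- the guard does not see the vertices below `u i`
    have hnot : (t, c) ∉ visits p (watchZone k (u i)) w (w + 2 * K) := by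
      rw [mem_visits]
      rintro ⟨-, x, hx, hcx⟩
      have h1 := hx.length_le
      rw [SimpleGraph.edist_comm] at hcx
      have h2 := length_le_add_of_edist_le hcx
      have h3 := length_le_add_of_edist_le hc
      rw [length_stem] at h1
      dsimp only at h2
      lia
    calc n + 1 ≤ (insert (t, c) (visits p (watchZone k (u i)) w (w + 2 * K))).card := by
          rw [Finset.card_insert_of_notMem hnot]
          lia
      _ ≤ _ := by
        refine Finset.card_le_card (Finset.insert_subset ?_ fun q hq => ?_)
        · exact mem_visits.mpr ⟨htw, v, List.suffix_rfl, hc⟩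
        · rw [mem_visits] at hq ⊢
          obtain ⟨hq, x, hx, hqx⟩ := hq
          exact ⟨hq, x, huv i hx, hqx⟩

/-- A high regular tree of large degree cannot be cleaned. -/
theorem unseenSet_regularTree_nontrivial (hD : 2 + 4 * (m * (2 * k + 2 + r)) < D)
    (hr : (2 * (2 * k + 2) * m + 2) * (2 * k + 2) ≤ r) (p : ℕ → Fin m → Word D r) (t : ℕ) :
    (unseenSet (regularTree D r) k p t).Nontrivial := by
  classical
  set K := 2 * k + 2 with hKdef
  have hr' : (2 * K * m + 1) * K + K ≤ r := by
    rw [add_mul] at hr ⊢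
    lia
  let o : Word D r := ⟨[], Nat.zero_le _⟩
  have ho : o.1.length + K ≤ r := by simp [o]; lia
  have hkey : ∀ i, (∀ c, ¬ i :: o.1 <:+ (p 0 c).1) →
      ∃ x ∈ below (stem o K ho i), x ∈ unseenSet (regularTree D r) k p t := by
    intro i hi
    by_contra! hclean
    obtain ⟨w, -, -, hw⟩ := exists_many_visits (by lia) (by lia) (2 * K * m + 1) (stem o K ho i)
      0 t (by rw [length_stem]; simp [o]; lia)
      (fun x hx c hc => hi c (cons_suffix_of_mem_watchZone (by lia) ⟨x, hx, hc⟩))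
      (Nat.zero_le _) hclean
    have := card_visits_le p (watchZone k (stem o K ho i)) w (w + 2 * K)
    rw [Nat.add_sub_cancel_left] at this
    lia
  have hfree : 1 < (Finset.univ.filter fun i : Fin D => ∀ c, ¬ i :: o.1 <:+ (p 0 c).1).card := by
    have h1 := Finset.card_filter_add_card_filter_not (s := Finset.univ)
      (fun i : Fin D => ∀ c, ¬ i :: o.1 <:+ (p 0 c).1)
    have h2 := card_visited_le (fun _ => p 0) o 0 1
    have h3 : (Finset.univ.filter fun i : Fin D => ¬ ∀ c, ¬ i :: o.1 <:+ (p 0 c).1) ⊆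
        Finset.univ.filter fun i => ¬ Unvisited (fun _ => p 0) o 0 1 i := by
      refine Finset.monotone_filter_right _ fun i _ hi h => hi (h 1 (by simp))
    have h4 := Finset.card_le_card h3
    rw [Finset.card_univ, Fintype.card_fin] at h1
    have h5 : m * 1 ≤ m * (K + r) := Nat.mul_le_mul_left _ (by lia)
    lia
  obtain ⟨i, hi, j, hj, hij⟩ := Finset.one_lt_card.mp hfree
  simp only [Finset.mem_filter, Finset.mem_univ, true_and] at hi hj
  obtain ⟨x, hx, hxP⟩ := hkey i hi
  obtain ⟨y, hy, hyP⟩ := hkey j hj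
  refine ⟨x, hxP, y, hyP, ?_⟩
  rintro rfl
  exact hij (eq_of_cons_suffix ((cons_suffix_stem (by lia)).trans hx)
    ((cons_suffix_stem (by lia)).trans hy))

/-- If the radius is large compared with the square of the visibility, then there is a tree of this
radius on which `m` cops do not suffice. -/
theorem exists_lt_zeta_regularTree {k m r : ℕ}
    (hr : (2 * (2 * k + 2) * m + 2) * (2 * k + 2) ≤ r) :
    ∃ D, natRadius (regularTree D r) = r ∧ m < zeta k (regularTree D r) := by
  refine ⟨3 + 4 * (m * (2 * k + 2 + r)), natRadius_regularTree (by lia), ?_⟩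
  by_contra! hle
  have : Nonempty (Word (3 + 4 * (m * (2 * k + 2 + r))) r) := ⟨⟨[], Nat.zero_le _⟩⟩
  obtain ⟨-, σ, hσ⟩ := zeta_spec k (regularTree (3 + 4 * (m * (2 * k + 2 + r))) r)
  refine not_isWinning_of_nontrivial_unseenSet (fun p t => ?_) σ hσ
  refine unseenSet_regularTree_nontrivial ?_ (le_trans ?_ hr) p t
  · have := Nat.mul_le_mul_right (2 * k + 2 + r) hle
    lia
  · gcongr

end Evasion

theorem exists_tendsto_zeta_atTop (f : ℝ → ℝ) (hf : ∀ x, 0 ≤ x → 0 ≤ f x)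
    (ho : (fun n : ℕ => f n) =o[atTop] (fun n : ℕ => √(n : ℝ))) :
    ∃ (V : ℕ → Type) (_ : ∀ n, Finite (V n)) (T : ∀ n, SimpleGraph (V n)),
      (∀ n, (T n).IsTree) ∧
      Tendsto (fun n => natRadius (T n)) atTop atTop ∧
      Tendsto (fun n => zeta ⌊f (natRadius (T n))⌋₊ (T n)) atTop atTop := by
  have key : ∀ n : ℕ, ∃ r D, n ≤ r ∧ natRadius (regularTree D r) = r ∧
      n < zeta ⌊f r⌋₊ (regularTree D r) := by
    intro n
    -- with `c = 16 * (n + 1)`, the radius has to be at least `c * (k + 1) ^ 2`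
    set c : ℝ := 16 * (n + 1) with hc
    have hc0 : 0 < c := by positivity
    have hlarge : Tendsto (fun n : ℕ => √(n : ℝ)) atTop atTop :=
      Real.tendsto_sqrt_atTop.comp tendsto_natCast_atTop_atTop
    obtain ⟨r, ⟨h1, h2⟩, h3⟩ := (((isLittleO_iff.mp ho (c := 1 / (2 * c)) (by positivity)).and
      (hlarge.eventually_ge_atTop (2 * c))).and (eventually_ge_atTop n)).exists
    rw [Real.norm_of_nonneg (Real.sqrt_nonneg _),
      Real.norm_of_nonneg (hf _ (Nat.cast_nonneg _))] at h1
    set k := ⌊f r⌋₊ with hk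
    have h4 : (k : ℝ) ≤ f r := Nat.floor_le (hf _ (Nat.cast_nonneg _))
    have h5 : c * (k + 1) ≤ √(r : ℝ) := by
      have h6 : c * k ≤ √(r : ℝ) / 2 := by
        calc c * k ≤ c * (1 / (2 * c) * √(r : ℝ)) := by gcongr; exact h4.trans h1
          _ = √(r : ℝ) / 2 := by field_simp
      linarith
    have h7 : c * (k + 1) ^ 2 ≤ r := by
      have hc1 : 1 ≤ c := by
        rw [hc]
        have : (0 : ℝ) ≤ n := Nat.cast_nonneg _
        linarith
      calc c * (k + 1) ^ 2 ≤ c * (c * (k + 1) ^ 2) := le_mul_of_one_le_left (by positivity) hc1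
        _ = (c * (k + 1)) ^ 2 := by ring
        _ ≤ √(r : ℝ) ^ 2 := by gcongr
        _ = r := Real.sq_sqrt (Nat.cast_nonneg _)
    have h8 : 16 * (n + 1) * (k + 1) ^ 2 ≤ r := by
      rw [hc] at h7
      exact_mod_cast h7
    have h9 : (2 * (2 * k + 2) * n + 2) * (2 * k + 2) ≤ r := by
      refine le_trans ?_ h8
      calc (2 * (2 * k + 2) * n + 2) * (2 * k + 2) = 8 * n * (k + 1) ^ 2 + 4 * (k + 1) := by ring
        _ ≤ 8 * n * (k + 1) ^ 2 + 4 * (k + 1) ^ 2 := by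
          gcongr
          exact Nat.le_self_pow two_ne_zero _
        _ ≤ 16 * (n + 1) * (k + 1) ^ 2 := by
          rw [← add_mul]
          gcongr
          lia
    obtain ⟨D, hrad, hz⟩ := exists_lt_zeta_regularTree h9
    exact ⟨r, D, h3, hrad, hz⟩
  choose r D hr hrad hz using key
  refine ⟨fun n => Word (D n) (r n), fun n => inferInstance, fun n => regularTree (D n) (r n),
    fun n => regularTree_isTree, ?_, ?_⟩
  · simp only [hrad]
    exact tendsto_atTop_mono hr tendsto_id
  · simp only [hrad]
    exact tendsto_atTop_mono (fun n => (hz n).le) tendsto_id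

end VisibilityLocalization

theorem mainTheorem2 :
    (∀ (V : ℕ → Type u) [∀ n, Finite (V n)] (T : ∀ n, SimpleGraph (V n)),
      (∀ n, (T n).IsTree) →
      Tendsto (fun n => natRadius (T n)) atTop atTop →
      ∀ f : ℝ → ℝ, ContinuousOn f (Set.Ici 0) → (∀ x, 0 ≤ x → 0 ≤ f x) →
      (fun n : ℕ => √(n : ℝ)) =O[atTop] (fun n : ℕ => f n) →
      ∃ d : ℕ,
        limsup (fun n => (VisibilityLocalization.zeta ⌊f (natRadius (T n))⌋₊ (T n) : ℕ∞)) atTop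
          ≤ d) ∧
    (∀ f : ℝ → ℝ, ContinuousOn f (Set.Ici 0) → (∀ x, 0 ≤ x → 0 ≤ f x) →
      (fun n : ℕ => f n) =o[atTop] (fun n : ℕ => √(n : ℝ)) →
      ∃ (V : ℕ → Type) (_ : ∀ n, Finite (V n)) (T : ∀ n, SimpleGraph (V n)),
        (∀ n, (T n).IsTree) ∧
        Tendsto (fun n => natRadius (T n)) atTop atTop ∧
        Tendsto (fun n => VisibilityLocalization.zeta ⌊f (natRadius (T n))⌋₊ (T n))
          atTop atTop) := by
  exact ⟨fun V _ T hT hrad f _ hf hO =>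
      VisibilityLocalization.exists_limsup_zeta_le V T hT hrad f hf hO,
    fun f _ hf ho => VisibilityLocalization.exists_tendsto_zeta_atTop f hf ho⟩
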